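/- Let $Q$ be a free abelian group of finite rank with a non-degenerate symmetric bilinear form $(\cdot,\cdot):Q\times Q\to\mathbb{Z}$, let $W=\Pi(\mathbb{C}\otimes_{\mathbb{Z}}Q)$ be its complexification with reversed parity, with the form extended bilinearly, and let $\varepsilon:Q\times Q\to\mathbb{C}^\times$ be a 2-cocycle such that $\varepsilon(\alpha,\beta)=(-1)^{(\alpha,\beta)+(\alpha,\alpha)(\beta,\beta)}\varepsilon(\beta,\alpha)$ for all $\alpha,\beta\in Q$. Let $V_Q^{\mathrm{super}}=V^1(W)\otimes\mathbb{C}_\varepsilon[Q]$ be the associated $N_K=1$ SUSY lattice vertex algebra. Here $V^1(W)$ is the Fock space generated from $|0\rangle$ by the creation operators $h_{(j|J)}$ ($h\in W$, $j<0$, $J\in\{0,1\}$), where $[h_{(m|0)},h'_{(n|0)}]=m(h,h')\delta_{m,-n}$ and $[h_{(m|1)},h'_{(n|1)}]=(h,h')\delta_{m,-n-1}$ are the only non-zero (super)commutators; $\mathbb{C}_\varepsilon[Q]$ is the twisted group algebra, $e^\alpha e^\beta=\varepsilon(\alpha,\beta)e^{\alpha+\beta}$, with $e^\alpha$ of parity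 $(\alpha,\alpha)$ mod $2$; $h_{(0|0)}$ acts on $V^1(W)\otimes e^\beta$ as $(h,\beta)$; the superfield of $h=h_{(-1|1)}|0\rangle$ is $h(z,\theta)=\sum_j z^{-1-j}(h_{(j|1)}+\theta h_{(j|0)})$; the superfield $\Gamma_\alpha$ of $1\otimes e^\alpha$ is $$\Gamma_\alpha(z,\theta)=e^\alpha z^{\alpha_{(0|0)}}\Bigl(1+\theta\sum_{j\in\mathbb{Z}}z^{-1-j}\alpha_{(j|1)}\Bigr)\exp\Bigl(-\sum_{j<0}\tfrac{z^{-j}}{j}\alpha_{(j|0)}\Bigr)\exp\Bigl(-\sum_{j>0}\tfrac{z^{-j}}{j}\alpha_{(j|0)}\Bigr);$$ the odd operator $S$ is determined by $[S,h_{(n|1)}]=h_{(n|0)}$, $[S,h_{(n|0)}]=-n\,h_{(n-1|1)}$ and $S(1\otimes e^\alpha)=\alpha_{(-1|1)}\otimes e^\alpha$, and $T=S^2$. Write $Y(a,z,\theta)=\sum_j z^{-1-j}(a_{(j|1)}+\theta a_{(j|0)})$ for the superfield of a state $a$, $:ab:\;=a_{(-1|1)}b$, and $[a_\Lambda b]=\sum_{j\ge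 0}\frac{\lambda^j}{j!}\bigl(a_{(j|0)}b+\chi\,a_{(j|1)}b\bigr)$, where $\chi^2=-\lambda$. Let $\{\alpha_i\}$ and $\{\alpha^i\}$ be dual bases of $W$, $(\alpha_i,\alpha^j)=\delta_{ij}$, and let $$G=\sum_i :(S\alpha_i)\alpha^i:\;\in V_Q^{\mathrm{super}}.$$ Then $G$ is an $N_K=1$ conformal (Neveu–Schwarz) vector of central charge $c=\tfrac32\operatorname{rank}Q$, that is, $$[G_\Lambda G]=(2T+3\lambda+\chi S)G+\tfrac{c}{3}\lambda^2\chi|0\rangle,\qquad G_{(0|0)}=2T,\qquad G_{(0|1)}=S,$$ and $G_{(1|0)}$ is diagonalizable on $V_Q^{\mathrm{super}}$; if $(\cdot,\cdot)$ is positive definite, then the eigenvalues of $G_{(1|0)}$ are real and bounded below and its eigenspaces are finite-dimensional. Every $h\in W$ is primary of conformal weight $\tfrac12$, i.e. $[G_\Lambda h]=(2T+\lambda+\chi S)h$, and for every $\alpha\in Q$ the superfield $\Gamma_\alpha$ is primary of conformal weight $\tfrac12(\alpha,\alpha)$, i.e. $$[G_\Lambda\Gamma_\alpha]=(2T+(\alpha,\alpha)\lambda+\chi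 S)\Gamma_\alpha .$$ -/

import Mathlib

open scoped TensorProduct

noncomputable section

namespace SUSYLattice

/-! ### Fields on a vector space -/

section Fields

variable {V : Type*} [AddCommGroup V] [Module ℂ V]

open scoped VertexOperator

/-- The field `∑ₙ f n z^(-1-n)`, for modes `f n` that on each vector vanish for large `n`. -/
def ofModes (f : ℤ → Module.End ℂ V) (hf : ∀ v, ∃ N : ℤ, ∀ n, N ≤ n → f n v = 0) :
    VertexOperator ℂ V :=
  VertexOperator.of_coeff (fun k => f (-k - 1)) (by
    intro v
    obtain ⟨N, hN⟩ := hf v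
    refine ⟨-N, fun k hk => ?_⟩
    by_contra h
    exact hk (hN _ (by omega)))

theorem ofModes_ncoeff (f : ℤ → Module.End ℂ V) (hf) (n : ℤ) : (ofModes f hf)[[n]] = f n := by
  rw [ofModes, VertexOperator.ncoeff_of_coeff]
  congr 1
  ring

theorem exists_ncoeff_eq_zero (A : VertexOperator ℂ V) (v : V) :
    ∃ N : ℤ, ∀ n, N ≤ n → (A[[n]]) v = 0 := by
  refine ⟨-HahnSeries.order ((HahnModule.of ℂ).symm (A v)), fun n hn => ?_⟩
  exact VertexOperator.ncoeff_eq_zero_of_lt_order A n v (by omega)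

/-- The derivative `∂_z A(z)`. -/
def fieldDeriv (A : VertexOperator ℂ V) : VertexOperator ℂ V :=
  ofModes (fun n => (-(n : ℂ)) • (A[[n - 1]])) (by
    intro v
    obtain ⟨N, hN⟩ := exists_ncoeff_eq_zero A v
    exact ⟨N + 1, fun n hn => by simp [hN (n - 1) (by omega)]⟩)

theorem finite_support_of_eventually {M : Type*} [Zero M] {f : ℕ → M} (N : ℤ)
    (h : ∀ j : ℕ, N ≤ j → f j = 0) : (Function.support f).Finite := by
  refine (Set.finite_lt_nat N.toNat).subset fun j hj => ?_
  by_contra hlt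
  exact hj (h j (by simp only [Set.mem_ofPred_eq] at hlt; omega))

theorem finite_support_left (A B : VertexOperator ℂ V) (n : ℤ) (v : V) :
    (Function.support fun j : ℕ => (A[[-(j : ℤ) - 1]]) ((B[[n + j]]) v)).Finite := by
  obtain ⟨N, hN⟩ := exists_ncoeff_eq_zero B v
  exact finite_support_of_eventually (N - n) fun j hj => by
    rw [hN _ (by omega), map_zero]

theorem finite_support_right (A B : VertexOperator ℂ V) (n : ℤ) (v : V) :
    (Function.support fun j : ℕ => (B[[n - j - 1]]) ((A[[(j : ℤ)]]) v)).Finite := by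
  obtain ⟨N, hN⟩ := exists_ncoeff_eq_zero A v
  exact finite_support_of_eventually N fun j hj => by
    rw [hN _ hj, map_zero]

/-- The mode `n` of the normally ordered product `:A(z)B(z):`, that is
`∑_{j<0} A_(j) B_(n-j-1) + σ ∑_{j≥0} B_(n-j-1) A_(j)`. -/
def nopMode (σ : ℂ) (A B : VertexOperator ℂ V) (n : ℤ) : Module.End ℂ V where
  toFun v := (∑ᶠ j : ℕ, (A[[-(j : ℤ) - 1]]) ((B[[n + j]]) v)) +
    σ • ∑ᶠ j : ℕ, (B[[n - j - 1]]) ((A[[(j : ℤ)]]) v)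
  map_add' v w := by
    simp only [map_add]
    rw [finsum_add_distrib (finite_support_left A B n v) (finite_support_left A B n w),
      finsum_add_distrib (finite_support_right A B n v) (finite_support_right A B n w), smul_add]
    abel
  map_smul' c v := by
    simp only [map_smul, RingHom.id_apply]
    rw [← smul_finsum, ← smul_finsum, smul_add, smul_comm σ c]

/-- The normally ordered product `:A(z)B(z):` of two fields. Here `σ` is the sign
`(-1)^(p(A)p(B))`. -/
def nop (σ : ℂ) (A B : VertexOperator ℂ V) : VertexOperator ℂ V :=
  ofModes (nopMode σ A B) (by
    intro v
    obtain ⟨N, hN⟩ := exists_ncoeff_eq_zero B v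
    obtain ⟨M, hM⟩ := exists_ncoeff_eq_zero A v
    choose K hK using fun j : ℕ => exists_ncoeff_eq_zero B ((A[[(j : ℤ)]]) v)
    obtain ⟨L, hL⟩ := ((Finset.range M.toNat).image fun j : ℕ => K j + j + 1).bddAbove
    refine ⟨max N L, fun n hn => ?_⟩
    have h1 : ∀ j : ℕ, (A[[-(j : ℤ) - 1]]) ((B[[n + j]]) v) = 0 := fun j => by
      rw [hN _ (by have := le_max_left N L; omega), map_zero]
    have h2 : ∀ j : ℕ, (B[[n - j - 1]]) ((A[[(j : ℤ)]]) v) = 0 := fun j => by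
      by_cases hj : M ≤ j
      · rw [hM _ hj, map_zero]
      · refine hK j _ ?_
        have : K j + j + 1 ≤ L := hL (Finset.mem_coe.2 (Finset.mem_image_of_mem (fun j : ℕ => K j + j + 1)
          (Finset.mem_range.2 (by omega : j < M.toNat))))
        have := le_max_right N L
        omega
    simp [nopMode, h1, h2])

end Fields

/-! ### `N_K = 1` supersymmetric structures, `Λ`-brackets and conformal vectors -/

/-- The data of an `N_K = 1` SUSY vertex algebra: the vacuum, the odd operator `S`, and the
components `Y(a, z)` at `θ = 0` of the superfields `Y(a, z, θ) = Y(a, z) + θ Y(S a, z)`. -/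
structure SUSYStructure (V : Type*) [AddCommGroup V] [Module ℂ V] where
  vac : V
  S : Module.End ℂ V
  Y : V →ₗ[ℂ] VertexOperator ℂ V

namespace SUSYStructure

variable {V : Type*} [AddCommGroup V] [Module ℂ V] (𝒱 : SUSYStructure V)

open scoped VertexOperator

/-- The translation operator `T = S²`. -/
def T : Module.End ℂ V := 𝒱.S * 𝒱.S

/-- The Fourier modes `a_(j|J)` of the superfield
`Y(a, z, θ) = ∑_j z^(-1-j) a_(j|1) + θ ∑_j z^(-1-j) a_(j|0)`. -/
def mode (a : V) (j : ℤ) (J : Fin 2) : Module.End ℂ V :=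
  if J = 0 then (𝒱.Y (𝒱.S a))[[j]] else (𝒱.Y a)[[j]]

/-- The normally ordered product `:ab: = a_(-1|1) b` of states. -/
def normalProd (a b : V) : V := 𝒱.mode a (-1) 1 b

/-- The `Λ`-bracket `[a_Λ b] = ∑_{j ≥ 0} λ^j / j! (a_(j|0) b + χ a_(j|1) b)`. A polynomial in the
even variable `λ` and the odd variable `χ` (where `χ² = -λ`), with coefficients in `V` written on
the right, is encoded by the family of its coefficients at `λ^j χ^J`. -/
def lambdaBracket (a b : V) : (ℕ × Fin 2) →₀ V :=
  Finsupp.ofSupportFinite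
    (fun p => ((p.1.factorial : ℂ)⁻¹) • 𝒱.mode a p.1 p.2 b) (by
      obtain ⟨N, hN⟩ := exists_ncoeff_eq_zero (𝒱.Y a) b
      obtain ⟨M, hM⟩ := exists_ncoeff_eq_zero (𝒱.Y (𝒱.S a)) b
      refine ((Set.finite_lt_nat (max N M).toNat).prod (Set.finite_univ (α := Fin 2))).subset ?_
      rintro ⟨j, J⟩ hj
      refine ⟨?_, Set.mem_univ _⟩
      by_contra hlt
      simp only [Set.mem_ofPred_eq] at hlt
      have := le_max_left N M
      have := le_max_right N M
      apply hj
      dsimp only [mode]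
      split_ifs
      · rw [hM _ (by omega), smul_zero]
      · rw [hN _ (by omega), smul_zero])

/-- The monomial `λ^j χ^J v`. -/
def mon (j : ℕ) (J : Fin 2) (v : V) : (ℕ × Fin 2) →₀ V := Finsupp.single (j, J) v

/-- `τ` is a Neveu–Schwarz vector of central charge `c`:
`[τ_Λ τ] = (2T + 3λ + χS) τ + (c/3) λ² χ |0⟩`. -/
def IsNeveuSchwarz (τ : V) (c : ℂ) : Prop :=
  𝒱.lambdaBracket τ τ =
    mon 0 0 ((2 : ℂ) • 𝒱.T τ) + mon 1 0 ((3 : ℂ) • τ) + mon 0 1 (𝒱.S τ) +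
      mon 2 1 ((c / 3) • 𝒱.vac)

/-- `τ` is an `N_K = 1` conformal vector of central charge `c`. -/
structure IsConformalVector (τ : V) (c : ℂ) : Prop where
  neveuSchwarz : 𝒱.IsNeveuSchwarz τ c
  mode_zero_zero : 𝒱.mode τ 0 0 = (2 : ℂ) • 𝒱.T
  mode_zero_one : 𝒱.mode τ 0 1 = 𝒱.S
  diagonalizable : ⨆ μ : ℂ, Module.End.eigenspace (𝒱.mode τ 1 0) μ = ⊤

/-- `a` is primary of conformal weight `Δ` with respect to `τ`:
`[τ_Λ a] = (2T + 2Δλ + χS) a`. -/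
def IsPrimary (τ a : V) (Δ : ℂ) : Prop :=
  𝒱.lambdaBracket τ a = mon 0 0 ((2 : ℂ) • 𝒱.T a) + mon 1 0 ((2 * Δ) • a) + mon 0 1 (𝒱.S a)

/-- The energy operator `τ_(1|0) / 2` has real eigenvalues bounded from below and
finite-dimensional eigenspaces. -/
def EnergyBoundedBelow (τ : V) : Prop :=
  (∃ C : ℝ, ∀ μ : ℂ, Module.End.HasEigenvalue (𝒱.mode τ 1 0) μ → ∃ x : ℝ, C ≤ x ∧ μ = x) ∧
    ∀ μ : ℂ, FiniteDimensional ℂ (Module.End.eigenspace (𝒱.mode τ 1 0) μ)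

end SUSYStructure

/-! ### The space `V¹(W) ⊗ ℂ_ε[Q]` -/

/-- Labels `(m, i)` of the creation operators `(b i)_(-m-1|J)` for a basis `b` of the lattice. -/
abbrev ModeIdx (r : ℕ) := ℕ ×ₗ Fin r

/-- Labels of the Poincaré–Birkhoff–Witt basis: `(ν, F, β)` stands for the vector
`∏_{(m,i)} ((b i)_(-m-1|0))^(ν (m,i)) · ∏_{(m,i) ∈ F} (b i)_(-m-1|1) |0⟩ ⊗ e^β`, where the odd
factors are written from left to right in increasing order. -/
abbrev FockIdx (r : ℕ) (Q : Type*) := (ModeIdx r →₀ ℕ) × Finset (ModeIdx r) × Q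

/-- The space `V¹(W) ⊗ ℂ_ε[Q]`. -/
abbrev Fock (r : ℕ) (Q : Type*) := FockIdx r Q →₀ ℂ

section Operators

variable {r : ℕ} {Q : Type*}

/-- The operator with prescribed values on the basis. -/
def onBasis (f : FockIdx r Q → Fock r Q) : Module.End ℂ (Fock r Q) :=
  Finsupp.linearCombination ℂ f

theorem onBasis_single (f : FockIdx r Q → Fock r Q) (s : FockIdx r Q) :
    onBasis f (Finsupp.single s 1) = f s := by
  simp [onBasis]

/-- Multiplication by the even generator with label `k`. -/
def evenCreate (k : ModeIdx r) : Module.End ℂ (Fock r Q) :=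
  onBasis fun s => Finsupp.single (s.1 + Finsupp.single k 1, s.2.1, s.2.2) 1

/-- Partial derivative by the even generator with label `k`. -/
def evenDeriv (k : ModeIdx r) : Module.End ℂ (Fock r Q) :=
  onBasis fun s => Finsupp.single (s.1 - Finsupp.single k 1, s.2.1, s.2.2) (s.1 k : ℂ)

/-- Left multiplication by the odd generator with label `k`. -/
def oddCreate (k : ModeIdx r) : Module.End ℂ (Fock r Q) :=
  onBasis fun s => if k ∈ s.2.1 then 0 else
    Finsupp.single (s.1, insert k s.2.1, s.2.2) ((-1) ^ (s.2.1.filter (· < k)).card)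

/-- Left partial derivative by the odd generator with label `k`. -/
def oddDeriv (k : ModeIdx r) : Module.End ℂ (Fock r Q) :=
  onBasis fun s => if k ∈ s.2.1 then
    Finsupp.single (s.1, s.2.1.erase k, s.2.2) ((-1) ^ (s.2.1.filter (· < k)).card) else 0

theorem trunc_of_basis (f : ℤ → Module.End ℂ (Fock r Q))
    (h : ∀ s, ∃ N : ℤ, ∀ n, N ≤ n → f n (Finsupp.single s 1) = 0) (v : Fock r Q) :
    ∃ N : ℤ, ∀ n, N ≤ n → f n v = 0 := by
  induction v using Finsupp.induction_linear with
  | zero => exact ⟨0, fun n _ => map_zero _⟩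
  | add v w hv hw =>
    obtain ⟨N, hN⟩ := hv
    obtain ⟨M, hM⟩ := hw
    exact ⟨max N M, fun n hn => by
      rw [map_add, hN n (le_trans (le_max_left _ _) hn), hM n (le_trans (le_max_right _ _) hn),
        add_zero]⟩
  | single s c =>
    obtain ⟨N, hN⟩ := h s
    refine ⟨N, fun n hn => ?_⟩
    rw [← mul_one c, ← smul_eq_mul, ← Finsupp.smul_single, map_smul, hN n hn, smul_zero]

theorem evenDeriv_eq_zero (s : FockIdx r Q) (k : ModeIdx r) (hk : s.1 k = 0) :
    evenDeriv k (Finsupp.single s 1) = 0 := by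
  simp [evenDeriv, onBasis_single, hk]

theorem oddDeriv_eq_zero (s : FockIdx r Q) (k : ModeIdx r) (hk : k ∉ s.2.1) :
    oddDeriv k (Finsupp.single s 1) = 0 := by
  simp [oddDeriv, onBasis_single, hk]

theorem exists_bound (F : Finset (ModeIdx r)) : ∃ N : ℕ, ∀ k ∈ F, (ofLex k).1 < N := by
  refine ⟨F.sup (fun k => (ofLex k).1) + 1, fun k hk => ?_⟩
  exact Nat.lt_succ_of_le (Finset.le_sup (f := fun k : ModeIdx r => (ofLex k).1) hk)

/-- The degree of a basis vector in the even generators, `(b i)_(-m-1|0)` having degree `m + 1`. -/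
def evenDegree (s : FockIdx r Q) : ℤ := s.1.sum fun k c => (c : ℤ) * ((ofLex k).1 + 1)

/-- The span of the basis vectors of degree at most `d`. -/
def degLE (r : ℕ) (Q : Type*) (d : ℤ) : Submodule ℂ (Fock r Q) :=
  Finsupp.supported ℂ ℂ {s | evenDegree s ≤ d}

/-- `A` lowers the degree by at least `q`. -/
def Lowers (q : ℕ) (A : Module.End ℂ (Fock r Q)) : Prop :=
  ∀ (d : ℤ), ∀ v ∈ degLE r Q d, A v ∈ degLE r Q (d - q)

theorem evenDegree_nonneg (s : FockIdx r Q) : 0 ≤ evenDegree s :=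
  Finset.sum_nonneg fun k _ => by positivity

theorem degLE_of_neg {d : ℤ} (hd : d < 0) {v : Fock r Q} (hv : v ∈ degLE r Q d) : v = 0 := by
  have : {s : FockIdx r Q | evenDegree s ≤ d} = ∅ := by
    ext s
    have := evenDegree_nonneg s
    simp only [Set.mem_ofPred_eq, Set.mem_empty_iff_false, iff_false]
    omega
  rw [degLE, this, Finsupp.supported_empty] at hv
  exact hv

theorem Lowers.zero (q : ℕ) : Lowers q (0 : Module.End ℂ (Fock r Q)) :=
  fun _ _ _ => Submodule.zero_mem _

theorem Lowers.smul {q : ℕ} {A : Module.End ℂ (Fock r Q)} (hA : Lowers q A) (c : ℂ) :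
    Lowers q (c • A) :=
  fun d v hv => Submodule.smul_mem _ _ (hA d v hv)

theorem Lowers.sum {ι : Type*} {q : ℕ} (t : Finset ι) {A : ι → Module.End ℂ (Fock r Q)}
    (hA : ∀ i ∈ t, Lowers q (A i)) : Lowers q (∑ i ∈ t, A i) := by
  intro d v hv
  rw [LinearMap.sum_apply]
  exact Submodule.sum_mem _ fun i hi => hA i hi d v hv

theorem Lowers.mul {p q : ℕ} {A A' : Module.End ℂ (Fock r Q)} (hA : Lowers p A)
    (hA' : Lowers q A') : Lowers (p + q) (A * A') := by
  intro d v hv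
  have := hA _ _ (hA' d v hv)
  rw [Module.End.mul_apply]
  convert this using 2
  push_cast
  ring

theorem lowers_evenDeriv (k : ModeIdx r) :
    Lowers ((ofLex k).1 + 1) (evenDeriv k : Module.End ℂ (Fock r Q)) := by
  intro d v hv
  rw [evenDeriv, onBasis, Finsupp.linearCombination_apply]
  refine Submodule.sum_mem _ fun s hs => Submodule.smul_mem _ _ ?_
  by_cases hk : s.1 k = 0
  · simp [hk]
  refine Finsupp.single_mem_supported ℂ _ ?_
  have hs' : evenDegree s ≤ d := hv hs
  have key : evenDegree s = evenDegree (s.1 - Finsupp.single k 1, s.2.1, s.2.2) +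
      ((ofLex k).1 + 1) := by
    have h1 : s.1 = (s.1 - Finsupp.single k 1) + Finsupp.single k 1 := by
      refine (tsub_add_cancel_of_le ?_).symm
      rw [Finsupp.single_le_iff]
      omega
    simp only [evenDegree]
    conv_lhs => rw [h1]
    rw [Finsupp.sum_add_index' (by simp) (by intros; push_cast; ring),
      Finsupp.sum_single_index (by simp)]
    simp
  simp only [Set.mem_ofPred_eq]
  push_cast
  omega

theorem lowers_coeff_pow {X : PowerSeries (Module.End ℂ (Fock r Q))}
    (hX : ∀ n, Lowers n (PowerSeries.coeff n X)) (m n : ℕ) :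
    Lowers n (PowerSeries.coeff n (X ^ m)) := by
  induction m generalizing n with
  | zero =>
    rw [pow_zero, PowerSeries.coeff_one]
    split_ifs with h
    · subst h
      intro d v hv
      simpa using hv
    · exact Lowers.zero n
  | succ m ih =>
    rw [pow_succ, PowerSeries.coeff_mul]
    refine Lowers.sum _ fun p hp => ?_
    rw [← Finset.HasAntidiagonal.mem_antidiagonal.1 hp]
    exact (ih p.1).mul (hX p.2)

end Operators

/-! ### The operators `h_(j|J)`, `e^α`, `S` and the vertex operators -/

section Lattice

variable {r : ℕ} {Q : Type*} [AddCommGroup Q]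
  (B : LinearMap.BilinForm ℤ Q) (b : Module.Basis (Fin r) ℤ Q) (ε : Q → Q → ℂˣ)

/-- The bilinear form on `W = ℂ ⊗ Q`. -/
def formW : LinearMap.BilinForm ℂ (ℂ ⊗[ℤ] Q) := LinearMap.BilinForm.baseChange ℂ B

/-- The inclusion of `Q` into `W`. -/
def toW (α : Q) : ℂ ⊗[ℤ] Q := 1 ⊗ₜ[ℤ] α

/-- The coordinates of `h ∈ W` in the basis `b`. -/
def coordW (h : ℂ ⊗[ℤ] Q) (i : Fin r) : ℂ := (Algebra.TensorProduct.basis ℂ b).repr h i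

/-- The operators `h_(n|0)`; they satisfy `[h_(m|0), h'_(n|0)] = m (h, h') δ_{m,-n}`, and
`h_(0|0)` is `(h, β)` on `V¹(W) ⊗ e^β`. -/
def evenMode (h : ℂ ⊗[ℤ] Q) : ℤ → Module.End ℂ (Fock r Q)
  | .ofNat 0 => onBasis fun s => Finsupp.single s (formW B h (toW s.2.2))
  | .ofNat (m + 1) =>
      ((m : ℂ) + 1) • ∑ i, formW B h (toW (b i)) • evenDeriv (toLex (m, i))
  | .negSucc m => ∑ i, coordW b h i • evenCreate (toLex (m, i))

/-- The operators `h_(n|1)`; they satisfy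
`h_(m|1) h'_(n|1) + h'_(n|1) h_(m|1) = (h, h') δ_{m,-n-1}`. -/
def oddMode (h : ℂ ⊗[ℤ] Q) : ℤ → Module.End ℂ (Fock r Q)
  | .ofNat m => ∑ i, formW B h (toW (b i)) • oddDeriv (toLex (m, i))
  | .negSucc m => ∑ i, coordW b h i • oddCreate (toLex (m, i))

/-- The even current `(S h)(z) = ∑ h_(n|0) z^(-1-n)`. -/
def evenField (h : ℂ ⊗[ℤ] Q) : VertexOperator ℂ (Fock r Q) :=
  ofModes (evenMode B b h) (trunc_of_basis _ (by
    intro s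
    obtain ⟨N, hN⟩ := exists_bound s.1.support
    refine ⟨N + 1, fun n hn => ?_⟩
    obtain ⟨m, rfl⟩ : ∃ m : ℕ, n = Int.ofNat (m + 1) := ⟨(n - 1).toNat, by simp; omega⟩
    simp only [evenMode, LinearMap.smul_apply, LinearMap.sum_apply]
    rw [Finset.sum_eq_zero, smul_zero]
    intro i _
    rw [evenDeriv_eq_zero, smul_zero]
    by_contra hk
    have := hN _ (Finsupp.mem_support_iff.2 hk)
    simp at this hn
    omega))

/-- The odd field `h(z) = ∑ h_(n|1) z^(-1-n)`. -/
def oddField (h : ℂ ⊗[ℤ] Q) : VertexOperator ℂ (Fock r Q) :=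
  ofModes (oddMode B b h) (trunc_of_basis _ (by
    intro s
    obtain ⟨N, hN⟩ := exists_bound s.2.1
    refine ⟨N, fun n hn => ?_⟩
    obtain ⟨m, rfl⟩ : ∃ m : ℕ, n = Int.ofNat m := ⟨n.toNat, by simp; omega⟩
    simp only [oddMode, LinearMap.smul_apply, LinearMap.sum_apply]
    refine Finset.sum_eq_zero fun i _ => ?_
    rw [oddDeriv_eq_zero, smul_zero]
    intro hk
    have := hN _ hk
    simp at this hn
    omega))

/-- Multiplication by `1 ⊗ e^α`, with the sign rule for moving `e^α`, of parity `(α, α)`, past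
the odd generators. -/
def expMul (α : Q) : Module.End ℂ (Fock r Q) :=
  onBasis fun s => Finsupp.single (s.1, s.2.1, α + s.2.2)
    ((-1 : ℂ) ^ (B α α * s.2.1.card) * (ε α s.2.2 : ℂ))

/-- The exponential `∑ X^m / m!` of a power series without constant term. -/
def expSeries {R : Type*} [Ring R] [Module ℂ R] (X : PowerSeries R) : PowerSeries R :=
  PowerSeries.mk fun n =>
    ∑ m ∈ Finset.range (n + 1), ((m.factorial : ℂ)⁻¹) • PowerSeries.coeff n (X ^ m)

/-- `exp (- ∑_{j<0} (z^(-j) / j) α_(j|0))`, a power series in `z` (the constant term of the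
exponent is zero). -/
def expMinus (α : Q) : PowerSeries (Module.End ℂ (Fock r Q)) :=
  expSeries (PowerSeries.mk fun n => ((n : ℂ)⁻¹) • evenMode B b (toW α) (-(n : ℤ)))

/-- `exp (- ∑_{j>0} (z^(-j) / j) α_(j|0))`, a power series in `z⁻¹` (the constant term of the
exponent is zero). -/
def expPlus (α : Q) : PowerSeries (Module.End ℂ (Fock r Q)) :=
  expSeries (PowerSeries.mk fun n => (-(n : ℂ)⁻¹) • evenMode B b (toW α) (n : ℤ))

/-- The coefficient of `z^k` in `expMinus`, for an integer `k`. -/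
def expMinusCoeff (α : Q) (k : ℤ) : Module.End ℂ (Fock r Q) :=
  if 0 ≤ k then PowerSeries.coeff k.toNat (expMinus B b α) else 0

/-- The mode `n` (the coefficient of `z^(-1-n)`) of
`e^α z^(α_(0|0)) exp (- ∑_{j<0} (z^(-j) / j) α_(j|0)) exp (- ∑_{j>0} (z^(-j) / j) α_(j|0))`. -/
def gammaMode (α : Q) (n : ℤ) : Module.End ℂ (Fock r Q) :=
  onBasis fun s => ∑ᶠ q : ℕ, expMul B ε α
    (expMinusCoeff B b α (q - 1 - n - B α s.2.2)
      (PowerSeries.coeff q (expPlus B b α) (Finsupp.single s 1)))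

theorem lowers_expPlus (α : Q) (q : ℕ) : Lowers q (PowerSeries.coeff q (expPlus B b α)) := by
  rw [expPlus, expSeries, PowerSeries.coeff_mk]
  refine Lowers.sum _ fun m _ => Lowers.smul (lowers_coeff_pow (fun n => ?_) m q) _
  rw [PowerSeries.coeff_mk]
  cases n with
  | zero => simpa using Lowers.zero 0
  | succ n =>
    have h : Lowers (n + 1) (evenMode B b (toW α) (Int.ofNat (n + 1))) := by
      rw [evenMode]
      refine Lowers.smul (Lowers.sum _ fun i _ => Lowers.smul ?_ _) _
      exact lowers_evenDeriv (toLex (n, i))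
    exact h.smul _

theorem expPlus_eq_zero (α : Q) (s : FockIdx r Q) (q : ℕ) (hq : evenDegree s < q) :
    PowerSeries.coeff q (expPlus B b α) (Finsupp.single s 1) = 0 :=
  degLE_of_neg (by omega : evenDegree s - (q : ℤ) < 0)
    (lowers_expPlus B b α q _ _ (Finsupp.single_mem_supported ℂ _ (le_refl (evenDegree s))))

/-- The vertex operator `Γ_α(z, θ)` at `θ = 0`. -/
def gammaField (α : Q) : VertexOperator ℂ (Fock r Q) :=
  ofModes (gammaMode B b ε α) (trunc_of_basis _ (by
    intro s
    refine ⟨evenDegree s - B α s.2.2, fun n hn => ?_⟩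
    rw [gammaMode, onBasis_single]
    refine finsum_eq_zero_of_forall_eq_zero fun q => ?_
    by_cases hq : evenDegree s < q
    · rw [expPlus_eq_zero B b α s q hq, map_zero, map_zero]
    · rw [expMinusCoeff, if_neg (by omega), LinearMap.zero_apply, map_zero]))

/-- The divided derivative `∂^m A(z) / m!`. -/
def dividedDeriv (m : ℕ) (A : VertexOperator ℂ (Fock r Q)) : VertexOperator ℂ (Fock r Q) :=
  ((m.factorial : ℂ)⁻¹) • fieldDeriv^[m] A

/-- The field of the state `∏_{k ∈ l} (b k.2)_(-k.1-1|1) |0⟩ ⊗ e^β`. -/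
def oddPart (β : Q) : List (ModeIdx r) → VertexOperator ℂ (Fock r Q)
  | [] => gammaField B b ε β
  | k :: l => nop ((-1 : ℂ) ^ ((l.length : ℤ) + B β β))
      (dividedDeriv (ofLex k).1 (oddField B b (toW (b (ofLex k).2)))) (oddPart β l)

/-- The field of the state `∏_{k ∈ l} (b k.2)_(-k.1-1|0) v`, where `A` is the field of `v`. -/
def evenPart (A : VertexOperator ℂ (Fock r Q)) : List (ModeIdx r) → VertexOperator ℂ (Fock r Q)
  | [] => A
  | k :: l => nop 1 (dividedDeriv (ofLex k).1 (evenField B b (toW (b (ofLex k).2))))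
      (evenPart A l)

/-- The operator `S`: the odd operator with `[S, h_(n|1)] = h_(n|0)`,
`[S, h_(n|0)] = -n h_(n-1|1)` and `S (1 ⊗ e^β) = β_(-1|1) ⊗ e^β`. -/
def opS : Module.End ℂ (Fock r Q) :=
  onBasis fun s =>
    (∑ k ∈ s.1.support, (((ofLex k).1 : ℂ) + 1) •
      oddCreate (toLex ((ofLex k).1 + 1, (ofLex k).2)) (evenDeriv k (Finsupp.single s 1))) +
    (∑ k ∈ s.2.1, evenCreate k (oddDeriv k (Finsupp.single s 1))) +
    oddMode B b (toW s.2.2) (-1) (Finsupp.single s 1)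

/-- The vacuum, `|0⟩ ⊗ 1`, where `1 = ε(0,0)⁻¹ e^0` is the unit of the twisted group algebra. -/
def vacuum : Fock r Q := Finsupp.single (0, ∅, 0) (((ε 0 0)⁻¹ : ℂˣ) : ℂ)

/-- The SUSY lattice vertex algebra `V_Q^super`. The field of a basis vector is the normally
ordered product of divided derivatives of the free fields and of a vertex operator:
`Y(h_(-m-1|J) v, z) = :(∂^m h^J(z) / m!) Y(v, z):`, where `h^1(z)` is the odd field `h(z)` and
`h^0(z)` is the even field `(S h)(z)`. -/
def vQ : SUSYStructure (Fock r Q) where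
  vac := vacuum ε
  S := opS B b
  Y := Finsupp.linearCombination ℂ fun s =>
    evenPart B b (oddPart B b ε s.2.2 (s.2.1.sort (· ≤ ·)))
      ((Finsupp.toMultiset s.1).sort (· ≤ ·))

/-- The state `h = h_(-1|1) |0⟩` attached to `h ∈ W`. -/
def stateW (h : ℂ ⊗[ℤ] Q) : Fock r Q := oddMode B b h (-1) (vacuum ε)

/-- The state `1 ⊗ e^α`, whose superfield is `Γ_α`. -/
def stateExp (r : ℕ) (α : Q) : Fock r Q := Finsupp.single (0, ∅, α) 1

/-- The vector `G = ∑ᵢ :(S αᵢ) αⁱ:` for two families `a`, `a'` in `W`. -/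
def vecG {κ : Type*} [Fintype κ] (a a' : κ → ℂ ⊗[ℤ] Q) : Fock r Q :=
  ∑ i, (vQ B b ε).normalProd ((vQ B b ε).S (stateW B b ε (a i))) (stateW B b ε (a' i))

end Lattice

end SUSYLattice

end

/-!
The modes `G_n` of the superfield of `G` are the quadratic operators
`∑ᵢ :(S αᵢ)(z) αⁱ(z):_n`, so that their supercommutators with the free fields,
`[h_(m|0), G_n] = m h_(n-1+m|1)` and `{h_(m|1), G_n} = h_(n+m|0)`, follow from the derivation
property of the normally ordered product. Completeness of the dual bases gives `G_0 = S`: after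
normal ordering, both are the same first-order differential operator on the polynomial superalgebra.
Hence the modes of the superfield of `S G` are the anticommutators `L_n = {S, G_n}`, and the
super-Jacobi identity gives `[L_n, h_(m|J)]`. Each `Λ`-bracket now comes from moving the modes with
index `n ≥ 0` to the right until they reach a ground vector `1 ⊗ e^α`. Finally `L_1` is diagonal in
the Poincaré–Birkhoff–Witt basis, with twice the conformal weight as eigenvalue, so its spectrum is
read off the basis labels.
-/

noncomputable section

namespace SUSYLattice

/-! ### Supercommutators -/

section SuperBracket

variable {R A : Type*} [CommRing R] [Ring A] [Algebra R A]

/-- The supercommutator `X Y - s Y X`, where `s` stands for the sign `(-1)^(p(X)p(Y))`. -/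
def superBracket (s : R) : A →ₗ[R] A →ₗ[R] A :=
  LinearMap.mul R A - s • (LinearMap.mul R A).flip

theorem superBracket_apply (s : R) (X Y : A) : superBracket s X Y = X * Y - s • (Y * X) := by
  simp [superBracket]

theorem superBracket_comm {s : R} (hs : s * s = 1) (X Y : A) :
    superBracket s Y X = -s • superBracket s X Y := by
  simp only [superBracket_apply, smul_sub, smul_smul, neg_mul, hs]
  module

theorem superBracket_one_eq_zero_iff {X Y : A} : superBracket (1 : R) X Y = 0 ↔ Commute X Y := by
  rw [superBracket_apply, one_smul, sub_eq_zero, commute_iff_eq]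

theorem superBracket_one_anticommutator_even (X Y E : A) :
    superBracket (1 : R) (superBracket (-1 : R) X Y) E =
      superBracket (-1 : R) X (superBracket (1 : R) Y E) +
        superBracket (-1 : R) (superBracket (1 : R) X E) Y := by
  simp only [superBracket_apply, neg_smul, one_smul]
  noncomm_ring

theorem superBracket_one_anticommutator_odd (X Y O : A) :
    superBracket (1 : R) (superBracket (-1 : R) X Y) O =
      superBracket (1 : R) X (superBracket (-1 : R) Y O) -
        superBracket (1 : R) (superBracket (-1 : R) X O) Y := by
  simp only [superBracket_apply, neg_smul, one_smul]
  noncomm_ring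

end SuperBracket

section OnVectors

variable {R M : Type*} [CommRing R] [AddCommGroup M] [Module R M]

theorem apply_apply_eq_superBracket (s : R) (X Y : Module.End R M) (v : M) :
    X (Y v) = superBracket s X Y v + s • Y (X v) := by
  simp [superBracket_apply]

theorem apply_apply_of_eigenvector {X Y : Module.End R M} {v : M} {c d : R}
    (hXY : superBracket (1 : R) X Y = c • Y) (hv : X v = d • v) : X (Y v) = (d + c) • Y v := by
  rw [apply_apply_eq_superBracket 1, hXY, hv, map_smul, LinearMap.smul_apply]
  module

end OnVectors

/-! ### Normally ordered products -/

section FieldLemmas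

open scoped VertexOperator

open Filter

variable {V : Type*} [AddCommGroup V] [Module ℂ V]

theorem vertexOperator_ext_ncoeff {A B : VertexOperator ℂ V} (h : ∀ n, A[[n]] = B[[n]]) :
    A = B := by
  apply HVertexOperator.coeff_inj
  funext n
  rw [VertexOperator.coeff_eq_ncoeff, VertexOperator.coeff_eq_ncoeff, h]

theorem fieldDeriv_ncoeff (A : VertexOperator ℂ V) (n : ℤ) :
    (fieldDeriv A)[[n]] = (-(n : ℂ)) • A[[n - 1]] := ofModes_ncoeff _ _ n

theorem nop_ncoeff (σ : ℂ) (A B : VertexOperator ℂ V) (n : ℤ) :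
    (nop σ A B)[[n]] = nopMode σ A B n := ofModes_ncoeff _ _ n

theorem nopMode_apply (σ : ℂ) (A B : VertexOperator ℂ V) (n : ℤ) (v : V) :
    nopMode σ A B n v = (∑ᶠ j : ℕ, (A[[-(j : ℤ) - 1]]) ((B[[n + j]]) v)) +
      σ • ∑ᶠ j : ℕ, (B[[n - j - 1]]) ((A[[(j : ℤ)]]) v) := rfl

theorem eventually_finsum_eq_sum_range {M : Type*} [AddCommMonoid M] {f : ℕ → M}
    (hf : (Function.support f).Finite) :
    ∀ᶠ N in atTop, ∑ᶠ j, f j = ∑ j ∈ Finset.range N, f j := by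
  obtain ⟨K, hK⟩ := hf.bddAbove
  filter_upwards [eventually_gt_atTop K] with N hN
  refine finsum_eq_sum_of_support_subset _ fun j hj => ?_
  exact Finset.mem_coe.2 (Finset.mem_range.2 ((hK hj).trans_lt hN))

theorem eventually_nopMode_apply (σ : ℂ) (A B : VertexOperator ℂ V) (n : ℤ) (v : V) :
    ∀ᶠ N in atTop, nopMode σ A B n v = ∑ j ∈ Finset.range N,
      ((A[[-(j : ℤ) - 1]]) ((B[[n + j]]) v) + σ • (B[[n - j - 1]]) ((A[[(j : ℤ)]]) v)) := by
  filter_upwards [eventually_finsum_eq_sum_range (finite_support_left A B n v),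
    eventually_finsum_eq_sum_range (finite_support_right A B n v)] with N hleft hright
  rw [nopMode_apply, hleft, hright, Finset.sum_add_distrib, Finset.smul_sum]

theorem nopMode_add_left (σ : ℂ) (A A' B : VertexOperator ℂ V) (n : ℤ) :
    nopMode σ (A + A') B n = nopMode σ A B n + nopMode σ A' B n := by
  ext v
  obtain ⟨N, h, h₁, h₂⟩ := ((eventually_nopMode_apply σ (A + A') B n v).and
    ((eventually_nopMode_apply σ A B n v).and (eventually_nopMode_apply σ A' B n v))).exists
  rw [LinearMap.add_apply, h, h₁, h₂, ← Finset.sum_add_distrib]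
  refine Finset.sum_congr rfl fun j _ => ?_
  simp only [map_add, Pi.add_apply, LinearMap.add_apply]
  module

theorem nopMode_add_right (σ : ℂ) (A B B' : VertexOperator ℂ V) (n : ℤ) :
    nopMode σ A (B + B') n = nopMode σ A B n + nopMode σ A B' n := by
  ext v
  obtain ⟨N, h, h₁, h₂⟩ := ((eventually_nopMode_apply σ A (B + B') n v).and
    ((eventually_nopMode_apply σ A B n v).and (eventually_nopMode_apply σ A B' n v))).exists
  rw [LinearMap.add_apply, h, h₁, h₂, ← Finset.sum_add_distrib]
  refine Finset.sum_congr rfl fun j _ => ?_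
  simp only [map_add, Pi.add_apply, LinearMap.add_apply]
  module

theorem nopMode_smul_left (σ c : ℂ) (A B : VertexOperator ℂ V) (n : ℤ) :
    nopMode σ (c • A) B n = c • nopMode σ A B n := by
  ext v
  simp only [nopMode_apply, map_smul, Pi.smul_apply, LinearMap.smul_apply]
  rw [← smul_finsum, ← smul_finsum, smul_add, smul_comm σ c]

theorem nopMode_smul_right (σ c : ℂ) (A B : VertexOperator ℂ V) (n : ℤ) :
    nopMode σ A (c • B) n = c • nopMode σ A B n := by
  ext v
  simp only [nopMode_apply, map_smul, Pi.smul_apply, LinearMap.smul_apply]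
  rw [← smul_finsum, ← smul_finsum, smul_add, smul_comm σ c]

theorem nopMode_zero_left (σ : ℂ) (B : VertexOperator ℂ V) (n : ℤ) : nopMode σ 0 B n = 0 := by
  simpa using nopMode_smul_left σ 0 0 B n

theorem nopMode_zero_right (σ : ℂ) (A : VertexOperator ℂ V) (n : ℤ) : nopMode σ A 0 n = 0 := by
  simpa using nopMode_smul_right σ 0 A 0 n

/-- The normally ordered product as a bilinear map on fields. -/
def nopₗ (σ : ℂ) : VertexOperator ℂ V →ₗ[ℂ] VertexOperator ℂ V →ₗ[ℂ] VertexOperator ℂ V :=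
  LinearMap.mk₂ ℂ (nop σ)
    (fun A A' B => vertexOperator_ext_ncoeff fun n => by
      simp only [map_add, Pi.add_apply, nop_ncoeff, nopMode_add_left])
    (fun c A B => vertexOperator_ext_ncoeff fun n => by
      simp only [map_smul, Pi.smul_apply, nop_ncoeff, nopMode_smul_left])
    (fun A B B' => vertexOperator_ext_ncoeff fun n => by
      simp only [map_add, Pi.add_apply, nop_ncoeff, nopMode_add_right])
    (fun c A B => vertexOperator_ext_ncoeff fun n => by
      simp only [map_smul, Pi.smul_apply, nop_ncoeff, nopMode_smul_right])

theorem nop_smul_right (σ c : ℂ) (A B : VertexOperator ℂ V) :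
    nop σ A (c • B) = c • nop σ A B := map_smul (nopₗ σ A) c B

/-- The derivative of fields as a linear map. -/
def fieldDerivₗ : VertexOperator ℂ V →ₗ[ℂ] VertexOperator ℂ V where
  toFun := fieldDeriv
  map_add' A B := vertexOperator_ext_ncoeff fun n => by
    simp only [map_add, Pi.add_apply, fieldDeriv_ncoeff, smul_add]
  map_smul' c A := vertexOperator_ext_ncoeff fun n => by
    simp only [map_smul, Pi.smul_apply, fieldDeriv_ncoeff, RingHom.id_apply, smul_comm c]

/-- The field `c z^(-1-j₀)`. -/
def constField (V : Type*) [AddCommGroup V] [Module ℂ V] (j₀ : ℤ) (c : ℂ) :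
    VertexOperator ℂ V :=
  ofModes (fun j => if j = j₀ then c • 1 else 0) fun v => ⟨j₀ + 1, fun n hn => by
    rw [if_neg (by omega), LinearMap.zero_apply]⟩

theorem constField_ncoeff (j₀ : ℤ) (c : ℂ) (n : ℤ) :
    (constField V j₀ c)[[n]] = if n = j₀ then c • 1 else 0 := ofModes_ncoeff _ _ n

theorem finsum_nat_eq_smul {g : ℕ → V} (j₀ : ℤ) (c : ℂ) (f : ℤ → V)
    (hg : ∀ j : ℕ, g j = if (j : ℤ) = j₀ then c • f j else 0) :
    ∑ᶠ j, g j = if 0 ≤ j₀ then c • f j₀ else 0 := by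
  split_ifs with h
  · lift j₀ to ℕ using h
    rw [finsum_eq_single _ j₀ fun j hj => by rw [hg, if_neg (by exact_mod_cast hj)],
      hg, if_pos rfl]
  · exact finsum_eq_zero_of_forall_eq_zero fun j => by rw [hg, if_neg (by omega)]

theorem nopMode_constField_left (j₀ : ℤ) (c : ℂ) (B : VertexOperator ℂ V) (n : ℤ) :
    nopMode 1 (constField V j₀ c) B n = c • B[[n - 1 - j₀]] := by
  ext v
  rw [nopMode_apply,
    finsum_nat_eq_smul (-j₀ - 1) c (fun i : ℤ => (B[[n + i]]) v) fun j => by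
      rw [constField_ncoeff]; split_ifs <;> first | omega | simp,
    finsum_nat_eq_smul j₀ c (fun i : ℤ => (B[[n - i - 1]]) v) fun j => by
      rw [constField_ncoeff]; split_ifs <;> simp]
  rcases le_or_gt 0 j₀ with h | h
  · rw [if_neg (by omega), if_pos h, zero_add, one_smul, LinearMap.smul_apply,
      show n - j₀ - 1 = n - 1 - j₀ by ring]
  · rw [if_pos (by omega), if_neg h.not_ge, smul_zero, add_zero, LinearMap.smul_apply,
      show n + (-j₀ - 1) = n - 1 - j₀ by ring]

theorem nopMode_constField_right (k₀ : ℤ) (c σ : ℂ) (A : VertexOperator ℂ V) (n : ℤ) :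
    nopMode σ A (constField V k₀ c) n = (if k₀ < n then σ * c else c) • A[[n - 1 - k₀]] := by
  ext v
  rw [nopMode_apply,
    finsum_nat_eq_smul (k₀ - n) c (fun i : ℤ => (A[[-i - 1]]) v) fun j => by
      rw [constField_ncoeff]; split_ifs <;> first | omega | simp,
    finsum_nat_eq_smul (n - 1 - k₀) c (fun i : ℤ => (A[[i]]) v) fun j => by
      rw [constField_ncoeff]; split_ifs <;> first | omega | simp]
  rcases lt_or_ge k₀ n with h | h
  · rw [if_neg (by omega), if_pos (by omega), if_pos h, zero_add, LinearMap.smul_apply, smul_smul]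
  · rw [if_pos (by omega), if_neg (by omega), if_neg h.not_gt, smul_zero, add_zero,
      LinearMap.smul_apply, show -(k₀ - n) - 1 = n - 1 - k₀ by ring]

theorem nop_one_constField_right (A : VertexOperator ℂ V) (c : ℂ) :
    nop 1 A (constField V (-1) c) = c • A :=
  vertexOperator_ext_ncoeff fun n => by
    rw [nop_ncoeff, nopMode_constField_right, one_mul, ite_self, map_smul, Pi.smul_apply,
      sub_neg_eq_add, sub_add_cancel]

theorem superBracket_nopMode {X : Module.End ℂ V} {A B A' B' : VertexOperator ℂ V} {s t : ℂ}
    (σ : ℂ) (hs : s * s = 1) (hA : ∀ j, superBracket s X (A[[j]]) = A'[[j]])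
    (hB : ∀ j, superBracket t X (B[[j]]) = B'[[j]]) (n : ℤ) :
    superBracket (s * t) X (nopMode σ A B n) =
      nopMode (σ * t) A' B n + s • nopMode (σ * s) A B' n := by
  have hXA (j : ℤ) (w : V) : X ((A[[j]]) w) = (A'[[j]]) w + s • (A[[j]]) (X w) := by
    rw [apply_apply_eq_superBracket s, hA]
  have hXB (j : ℤ) (w : V) : X ((B[[j]]) w) = (B'[[j]]) w + t • (B[[j]]) (X w) := by
    rw [apply_apply_eq_superBracket t, hB]
  ext v
  obtain ⟨N, h, hX, h₁, h₂⟩ := ((eventually_nopMode_apply σ A B n v).and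
    ((eventually_nopMode_apply σ A B n (X v)).and
      ((eventually_nopMode_apply (σ * t) A' B n v).and
        (eventually_nopMode_apply (σ * s) A B' n v)))).exists
  simp only [superBracket_apply, LinearMap.sub_apply, LinearMap.add_apply, LinearMap.smul_apply,
    Module.End.mul_apply]
  rw [h, hX, h₁, h₂, map_sum, Finset.smul_sum, Finset.smul_sum, ← Finset.sum_sub_distrib,
    ← Finset.sum_add_distrib]
  refine Finset.sum_congr rfl fun j _ => ?_
  have hσ : s * (σ * s) = σ := by rw [mul_left_comm, hs, mul_one]
  simp only [hXA, hXB, map_add, map_smul, smul_add, smul_smul, hσ]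
  module

theorem finsum_int_eq_add {M : Type*} [AddCommMonoid M] {f : ℤ → M}
    (hf : (Function.support f).Finite) :
    ∑ᶠ j, f j = (∑ᶠ j : ℕ, f (-(j : ℤ) - 1)) + ∑ᶠ j : ℕ, f j := by
  have hneg : Set.range (fun j : ℕ => -(j : ℤ) - 1) = {j | j < 0} := by
    ext j
    exact ⟨by rintro ⟨i, rfl⟩; simp only [Set.mem_ofPred_eq]; omega,
      fun hj => ⟨(-j - 1).toNat, by simp only [Set.mem_ofPred_eq] at hj ⊢; omega⟩⟩
  have hnonneg : Set.range (fun j : ℕ => (j : ℤ)) = {j | j < 0}ᶜ := by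
    ext j
    simp only [Set.mem_range, Set.mem_compl_iff, Set.mem_ofPred_eq, not_lt]
    exact ⟨by rintro ⟨i, rfl⟩; positivity, fun hj => ⟨j.toNat, by omega⟩⟩
  rw [← finsum_mem_univ, ← Set.union_compl_self {j : ℤ | j < 0},
    finsum_mem_union' disjoint_compl_right (hf.subset Set.inter_subset_right)
    (hf.subset Set.inter_subset_right), ← hnonneg, ← hneg,
    finsum_mem_range fun i j h => by simpa using h, finsum_mem_range Nat.cast_injective]

theorem nopMode_one_eq_finsum (A B : VertexOperator ℂ V) (n : ℤ) (v : V) :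
    nopMode 1 A B n v = ∑ᶠ j : ℤ, if j < 0 then (A[[j]]) ((B[[n - 1 - j]]) v) else
      (B[[n - 1 - j]]) ((A[[j]]) v) := by
  obtain ⟨N, hN⟩ := exists_ncoeff_eq_zero A v
  obtain ⟨K, hK⟩ := exists_ncoeff_eq_zero B v
  rw [finsum_int_eq_add, nopMode_apply, one_smul]
  · congr 1
    · refine finsum_congr fun j => ?_
      rw [if_pos (by omega), show n - 1 - (-(j : ℤ) - 1) = n + j by ring]
    · refine finsum_congr fun j => ?_
      rw [if_neg (by omega), show n - 1 - (j : ℤ) = n - j - 1 by ring]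
  · refine (Set.finite_Icc (min 0 (n - 1 - K)) (max 0 N)).subset fun j => ?_
    contrapose
    intro hj
    simp only [Set.mem_Icc, not_and_or, not_le] at hj
    rw [Function.notMem_support]
    split_ifs with h
    · rw [hK _ (by omega), map_zero]
    · rw [hN _ (by omega), map_zero]

theorem nopMode_swap {A B : VertexOperator ℂ V} {n : ℤ}
    (h : ∀ j, (j < 0 ↔ 0 ≤ n - 1 - j) ∨ Commute (A[[j]]) (B[[n - 1 - j]])) :
    nopMode 1 A B n = nopMode 1 B A n := by
  ext v
  rw [nopMode_one_eq_finsum, nopMode_one_eq_finsum, ← finsum_comp_equiv (Equiv.subLeft (n - 1))]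
  refine finsum_congr fun j => ?_
  simp only [Equiv.subLeft_apply, sub_sub_cancel]
  have hj := h (n - 1 - j)
  rw [sub_sub_cancel] at hj
  rcases hj with hj | hj
  · split_ifs <;> first | rfl | omega
  · have hv := LinearMap.congr_fun hj.eq v
    simp only [Module.End.mul_apply] at hv
    rw [hv, ite_self, ite_self]

end FieldLemmas

/-! ### Canonical (anti)commutation relations -/

section CanonicalRelations

variable {r : ℕ} {Q : Type*}

theorem end_ext_single {X Y : Module.End ℂ (Fock r Q)}
    (h : ∀ s, X (Finsupp.single s 1) = Y (Finsupp.single s 1)) : X = Y :=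
  Finsupp.lhom_ext' fun s => LinearMap.ext_ring (h s)

theorem onBasis_single_smul (f : FockIdx r Q → Fock r Q) (s : FockIdx r Q) (c : ℂ) :
    onBasis f (Finsupp.single s c) = c • f s :=
  Finsupp.linearCombination_single ℂ c s

theorem evenCreate_single (k : ModeIdx r) (s : FockIdx r Q) (c : ℂ) :
    evenCreate k (Finsupp.single s c) =
      Finsupp.single (s.1 + Finsupp.single k 1, s.2.1, s.2.2) c := by
  simp [evenCreate, onBasis_single_smul]

theorem evenDeriv_single (k : ModeIdx r) (s : FockIdx r Q) (c : ℂ) :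
    evenDeriv k (Finsupp.single s c) =
      Finsupp.single (s.1 - Finsupp.single k 1, s.2.1, s.2.2) (c * s.1 k) := by
  simp [evenDeriv, onBasis_single_smul]

/-- The sign `(-1)^#{x ∈ F | x < k}` of moving the odd generator with label `k` past the generators
of `F` that precede it. -/
def oddSign (F : Finset (ModeIdx r)) (k : ModeIdx r) : ℂ := (-1) ^ (F.filter (· < k)).card

theorem oddSign_mul_self (F : Finset (ModeIdx r)) (k : ModeIdx r) :
    oddSign F k * oddSign F k = 1 := by
  rw [oddSign, ← mul_pow, neg_one_mul, neg_neg, one_pow]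

theorem oddSign_insert {F : Finset (ModeIdx r)} {l : ModeIdx r} (hl : l ∉ F) (k : ModeIdx r) :
    oddSign (insert l F) k = if l < k then -oddSign F k else oddSign F k := by
  rw [oddSign, oddSign, Finset.filter_insert]
  split_ifs
  · rw [Finset.card_insert_of_notMem (by simp [hl]), pow_succ, mul_neg_one]
  · rfl

theorem oddSign_erase {F : Finset (ModeIdx r)} {l : ModeIdx r} (hl : l ∈ F) (k : ModeIdx r) :
    oddSign (F.erase l) k = if l < k then -oddSign F k else oddSign F k := by
  have h := oddSign_insert (F.notMem_erase l) k
  rw [Finset.insert_erase hl] at h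
  rw [h]
  split_ifs <;> ring

theorem oddCreate_single (k : ModeIdx r) (s : FockIdx r Q) (c : ℂ) :
    oddCreate k (Finsupp.single s c) = if k ∈ s.2.1 then 0 else
      Finsupp.single (s.1, insert k s.2.1, s.2.2) (c * oddSign s.2.1 k) := by
  rw [oddCreate, onBasis_single_smul]
  split_ifs <;> simp [oddSign]

theorem oddDeriv_single (k : ModeIdx r) (s : FockIdx r Q) (c : ℂ) :
    oddDeriv k (Finsupp.single s c) = if k ∈ s.2.1 then
      Finsupp.single (s.1, s.2.1.erase k, s.2.2) (c * oddSign s.2.1 k) else 0 := by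
  rw [oddDeriv, onBasis_single_smul]
  split_ifs <;> simp [oddSign]

theorem evenCreate_commute (k l : ModeIdx r) :
    Commute (evenCreate k : Module.End ℂ (Fock r Q)) (evenCreate l) :=
  end_ext_single fun s => by
    simp only [Module.End.mul_apply, evenCreate_single, add_right_comm]

theorem evenDeriv_commute (k l : ModeIdx r) :
    Commute (evenDeriv k : Module.End ℂ (Fock r Q)) (evenDeriv l) := by
  rcases eq_or_ne k l with rfl | h
  · rfl
  refine end_ext_single fun s => ?_
  simp only [Module.End.mul_apply, evenDeriv_single, tsub_right_comm (b := Finsupp.single l 1)]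
  simp [h, h.symm, mul_comm]

theorem single_add_single_tsub_single {k l : ModeIdx r} (h : k ≠ l) (ν : ModeIdx r →₀ ℕ) :
    ν + Finsupp.single l 1 - Finsupp.single k 1 = ν - Finsupp.single k 1 + Finsupp.single l 1 := by
  ext x
  rcases eq_or_ne x k with rfl | hx
  · simp [h.symm]
  · simp [Finsupp.single_apply, hx.symm]

theorem superBracket_evenDeriv_evenCreate (k l : ModeIdx r) :
    superBracket (1 : ℂ) (evenDeriv k : Module.End ℂ (Fock r Q)) (evenCreate l) =
      if k = l then 1 else 0 := by
  rw [superBracket_apply, one_smul, sub_eq_iff_eq_add]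
  refine end_ext_single fun ⟨ν, F, β⟩ => ?_
  simp only [Module.End.mul_apply, evenDeriv_single, evenCreate_single, LinearMap.add_apply]
  rcases eq_or_ne k l with rfl | h
  · by_cases hk : ν k = 0
    · simp [hk]
    · have hν : ν - Finsupp.single k 1 + Finsupp.single k 1 = ν :=
        tsub_add_cancel_of_le (by rw [Finsupp.single_le_iff]; omega)
      simp [hν, ← Finsupp.single_add, add_comm]
  · simp [h, single_add_single_tsub_single h]

theorem superBracket_oddCreate_oddCreate (k l : ModeIdx r) :
    superBracket (-1 : ℂ) (oddCreate k : Module.End ℂ (Fock r Q)) (oddCreate l) = 0 := by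
  rw [superBracket_apply, sub_eq_zero]
  refine end_ext_single fun ⟨ν, F, β⟩ => ?_
  simp only [Module.End.mul_apply, oddCreate_single, LinearMap.smul_apply, neg_one_smul]
  rcases eq_or_ne k l with rfl | h
  · split_ifs <;> simp [oddCreate_single]
  by_cases hk : k ∈ F <;> by_cases hl : l ∈ F <;>
    simp only [hk, hl, if_true, if_false, map_zero, neg_zero, oddCreate_single,
      Finset.mem_insert, or_true, h, h.symm, or_self]
  rw [oddSign_insert hk, oddSign_insert hl, Finset.insert_comm, ← Finsupp.single_neg]
  congr 1
  rcases lt_or_gt_of_ne h with hlt | hlt <;> simp [hlt, hlt.not_gt] <;> ring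

theorem superBracket_oddDeriv_oddDeriv (k l : ModeIdx r) :
    superBracket (-1 : ℂ) (oddDeriv k : Module.End ℂ (Fock r Q)) (oddDeriv l) = 0 := by
  rw [superBracket_apply, sub_eq_zero]
  refine end_ext_single fun ⟨ν, F, β⟩ => ?_
  simp only [Module.End.mul_apply, oddDeriv_single, LinearMap.smul_apply, neg_one_smul]
  rcases eq_or_ne k l with rfl | h
  · split_ifs <;> simp [oddDeriv_single]
  by_cases hk : k ∈ F <;> by_cases hl : l ∈ F <;>
    simp only [hk, hl, if_true, if_false, map_zero, neg_zero, oddDeriv_single,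
      Finset.mem_erase, h, h.symm, and_self, ne_eq, not_false_eq_true, and_false]
  rw [oddSign_erase hk, oddSign_erase hl, Finset.erase_right_comm, ← Finsupp.single_neg]
  congr 1
  rcases lt_or_gt_of_ne h with hlt | hlt <;> simp [hlt, hlt.not_gt, mul_comm]

theorem superBracket_oddDeriv_oddCreate (k l : ModeIdx r) :
    superBracket (-1 : ℂ) (oddDeriv k : Module.End ℂ (Fock r Q)) (oddCreate l) =
      if k = l then 1 else 0 := by
  rw [superBracket_apply, sub_eq_iff_eq_add]
  refine end_ext_single fun ⟨ν, F, β⟩ => ?_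
  simp only [Module.End.mul_apply, oddDeriv_single, oddCreate_single, LinearMap.add_apply,
    LinearMap.smul_apply, neg_one_smul]
  rcases eq_or_ne k l with rfl | h
  · by_cases hk : k ∈ F
    · simp [hk, oddCreate_single, oddSign_erase, oddSign_mul_self]
    · simp [hk, oddDeriv_single, oddSign_insert, oddSign_mul_self]
  by_cases hk : k ∈ F <;> by_cases hl : l ∈ F <;>
    simp only [hk, hl, if_true, if_false, map_zero, neg_zero, oddDeriv_single, oddCreate_single,
      Finset.mem_erase, Finset.mem_insert, h, h.symm, and_self, ne_eq, not_false_eq_true,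
      and_false, or_self, LinearMap.zero_apply, add_zero, or_true]
  rw [oddSign_erase hk, oddSign_insert hl, Finset.erase_insert_of_ne h.symm, ← Finsupp.single_neg]
  rcases lt_or_gt_of_ne h with hlt | hlt <;> simp [hlt, hlt.not_gt, mul_comm]

theorem evenCreate_commute_oddCreate (k l : ModeIdx r) :
    Commute (evenCreate k : Module.End ℂ (Fock r Q)) (oddCreate l) := by
  refine end_ext_single fun s => ?_
  simp only [Module.End.mul_apply, evenCreate_single, oddCreate_single]
  split_ifs <;> simp [evenCreate_single]

theorem evenCreate_commute_oddDeriv (k l : ModeIdx r) :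
    Commute (evenCreate k : Module.End ℂ (Fock r Q)) (oddDeriv l) := by
  refine end_ext_single fun s => ?_
  simp only [Module.End.mul_apply, evenCreate_single, oddDeriv_single]
  split_ifs <;> simp [evenCreate_single]

theorem evenDeriv_commute_oddCreate (k l : ModeIdx r) :
    Commute (evenDeriv k : Module.End ℂ (Fock r Q)) (oddCreate l) := by
  refine end_ext_single fun s => ?_
  simp only [Module.End.mul_apply, evenDeriv_single, oddCreate_single]
  split_ifs <;> simp [evenDeriv_single, mul_comm]

theorem evenDeriv_commute_oddDeriv (k l : ModeIdx r) :
    Commute (evenDeriv k : Module.End ℂ (Fock r Q)) (oddDeriv l) := by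
  refine end_ext_single fun s => ?_
  simp only [Module.End.mul_apply, evenDeriv_single, oddDeriv_single]
  split_ifs <;> simp [evenDeriv_single, mul_comm]

end CanonicalRelations

section LinearCombinations

variable {R A ι κ : Type*} [CommRing R] [Ring A] [Algebra R A] [Fintype ι] [Fintype κ]

theorem superBracket_sum_smul (s : R) (x : ι → R) (y : κ → R) (X : ι → A) (Y : κ → A) :
    superBracket s (∑ i, x i • X i) (∑ j, y j • Y j) =
      ∑ i, ∑ j, (x i * y j) • superBracket s (X i) (Y j) := by
  simp only [map_sum, map_smul, LinearMap.sum_apply, LinearMap.smul_apply, Finset.smul_sum,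
    smul_smul]
  rw [Finset.sum_comm]
  simp only [mul_comm]

theorem superBracket_sum_smul_eq_smul [DecidableEq ι] {s : R} {X Y : ι → A} {c : A}
    (h : ∀ i j, superBracket s (X i) (Y j) = if i = j then c else 0) (x y : ι → R) :
    superBracket s (∑ i, x i • X i) (∑ j, y j • Y j) = (∑ i, x i * y i) • c := by
  simp only [superBracket_sum_smul, h, smul_ite, smul_zero, Finset.sum_ite_eq, Finset.mem_univ,
    if_true, Finset.sum_smul]

end LinearCombinations

/-! ### Commutation relations of the modes -/

section ModeRelations

open scoped VertexOperator

variable {r : ℕ} {Q : Type*} [AddCommGroup Q]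
  (B : LinearMap.BilinForm ℤ Q) (b : Module.Basis (Fin r) ℤ Q)

theorem formW_toW (α β : Q) : formW B (toW α) (toW β) = (B α β : ℂ) := by
  simp [formW, toW]

theorem formW_symm {B : LinearMap.BilinForm ℤ Q} (hB : B.IsSymm) (h h' : ℂ ⊗[ℤ] Q) :
    formW B h h' = formW B h' h :=
  (LinearMap.BilinForm.IsSymm.baseChange ℂ ⟨hB.eq⟩).eq h h'

theorem coordW_toW_basis (l i : Fin r) : coordW b (toW (b l)) i = if l = i then 1 else 0 := by
  simp [coordW, toW, Finsupp.single_apply]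

theorem sum_coordW_smul (h : ℂ ⊗[ℤ] Q) : ∑ i, coordW b h i • toW (b i) = h := by
  conv_rhs => rw [← (Algebra.TensorProduct.basis ℂ b).sum_repr h]
  simp [coordW, toW]

theorem sum_formW_mul_coordW (h h' : ℂ ⊗[ℤ] Q) :
    ∑ i, formW B h (toW (b i)) * coordW b h' i = formW B h h' := by
  conv_rhs => rw [← sum_coordW_smul b h']
  simp [mul_comm]

theorem evenMode_zero_single (h : ℂ ⊗[ℤ] Q) (s : FockIdx r Q) (c : ℂ) :
    evenMode B b h 0 (Finsupp.single s c) = formW B h (toW s.2.2) • Finsupp.single s c := by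
  change onBasis _ _ = _
  rw [onBasis_single_smul, Finsupp.smul_single, Finsupp.smul_single, smul_eq_mul, smul_eq_mul,
    mul_comm]

theorem evenMode_succ (h : ℂ ⊗[ℤ] Q) (m : ℕ) :
    (evenMode B b h ((m : ℤ) + 1) : Module.End ℂ (Fock r Q)) =
      ∑ i, (((m : ℂ) + 1) * formW B h (toW (b i))) • evenDeriv (toLex (m, i)) := by
  simp only [mul_smul, ← Finset.smul_sum]
  rfl

theorem evenMode_neg (h : ℂ ⊗[ℤ] Q) (m : ℕ) :
    (evenMode B b h (-(m : ℤ) - 1) : Module.End ℂ (Fock r Q)) =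
      ∑ i, coordW b h i • evenCreate (toLex (m, i)) := by
  rw [show -(m : ℤ) - 1 = Int.negSucc m by rw [Int.negSucc_eq]; ring]
  rfl

theorem oddMode_natCast (h : ℂ ⊗[ℤ] Q) (m : ℕ) :
    (oddMode B b h (m : ℤ) : Module.End ℂ (Fock r Q)) =
      ∑ i, formW B h (toW (b i)) • oddDeriv (toLex (m, i)) := rfl

theorem oddMode_neg (h : ℂ ⊗[ℤ] Q) (m : ℕ) :
    (oddMode B b h (-(m : ℤ) - 1) : Module.End ℂ (Fock r Q)) =
      ∑ i, coordW b h i • oddCreate (toLex (m, i)) := by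
  rw [show -(m : ℤ) - 1 = Int.negSucc m by rw [Int.negSucc_eq]; ring]
  rfl

theorem evenMode_basis_neg (l : Fin r) (m : ℕ) :
    (evenMode B b (toW (b l)) (-(m : ℤ) - 1) : Module.End ℂ (Fock r Q)) =
      evenCreate (toLex (m, l)) := by
  simp [evenMode_neg, coordW_toW_basis]

theorem oddMode_basis_neg (l : Fin r) (m : ℕ) :
    (oddMode B b (toW (b l)) (-(m : ℤ) - 1) : Module.End ℂ (Fock r Q)) =
      oddCreate (toLex (m, l)) := by
  simp [oddMode_neg, coordW_toW_basis]

theorem int_eq_natCast_or_neg (n : ℤ) : (∃ m : ℕ, n = m) ∨ ∃ m : ℕ, n = -(m : ℤ) - 1 := by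
  rcases le_or_gt 0 n with h | h
  · exact Or.inl ⟨n.toNat, by omega⟩
  · exact Or.inr ⟨(-n - 1).toNat, by omega⟩

theorem int_eq_zero_or_succ_or_neg (n : ℤ) :
    n = 0 ∨ (∃ m : ℕ, n = (m : ℤ) + 1) ∨ ∃ m : ℕ, n = -(m : ℤ) - 1 := by
  rcases int_eq_natCast_or_neg n with ⟨_ | m, rfl⟩ | hn
  · exact Or.inl Nat.cast_zero
  · exact Or.inr (Or.inl ⟨m, by push_cast; ring⟩)
  · exact Or.inr (Or.inr hn)

/-- The modes `h_(n|0)` as a linear function of `h`. -/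
def evenModeₗ (n : ℤ) : ℂ ⊗[ℤ] Q →ₗ[ℂ] Module.End ℂ (Fock r Q) where
  toFun h := evenMode B b h n
  map_add' h h' := by
    rcases int_eq_zero_or_succ_or_neg n with rfl | ⟨m, rfl⟩ | ⟨m, rfl⟩
    · exact end_ext_single fun s => by
        simp only [LinearMap.add_apply, evenMode_zero_single, map_add, add_smul]
    · simp only [evenMode_succ, map_add, LinearMap.add_apply, mul_add, add_smul,
        Finset.sum_add_distrib]
    · simp only [evenMode_neg, coordW, map_add, Finsupp.add_apply, add_smul,
        Finset.sum_add_distrib]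
  map_smul' c h := by
    rcases int_eq_zero_or_succ_or_neg n with rfl | ⟨m, rfl⟩ | ⟨m, rfl⟩
    · exact end_ext_single fun s => by
        simp only [LinearMap.smul_apply, evenMode_zero_single, map_smul, smul_assoc,
          RingHom.id_apply]
    · simp only [evenMode_succ, map_smul, LinearMap.smul_apply, smul_eq_mul, Finset.smul_sum,
        smul_smul, mul_left_comm c, RingHom.id_apply]
    · simp only [evenMode_neg, coordW, map_smul, Finsupp.smul_apply, smul_assoc, Finset.smul_sum,
        RingHom.id_apply]

/-- The modes `h_(n|1)` as a linear function of `h`. -/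
def oddModeₗ (n : ℤ) : ℂ ⊗[ℤ] Q →ₗ[ℂ] Module.End ℂ (Fock r Q) where
  toFun h := oddMode B b h n
  map_add' h h' := by
    rcases int_eq_natCast_or_neg n with ⟨m, rfl⟩ | ⟨m, rfl⟩
    · simp only [oddMode_natCast, map_add, LinearMap.add_apply, add_smul, Finset.sum_add_distrib]
    · simp only [oddMode_neg, coordW, map_add, Finsupp.add_apply, add_smul, Finset.sum_add_distrib]
  map_smul' c h := by
    rcases int_eq_natCast_or_neg n with ⟨m, rfl⟩ | ⟨m, rfl⟩
    · simp only [oddMode_natCast, map_smul, LinearMap.smul_apply, smul_assoc, Finset.smul_sum,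
        RingHom.id_apply]
    · simp only [oddMode_neg, coordW, map_smul, Finsupp.smul_apply, smul_assoc, Finset.smul_sum,
        RingHom.id_apply]

theorem evenModeₗ_apply (n : ℤ) (h : ℂ ⊗[ℤ] Q) :
    (evenModeₗ B b n h : Module.End ℂ (Fock r Q)) = evenMode B b h n := rfl

theorem oddModeₗ_apply (n : ℤ) (h : ℂ ⊗[ℤ] Q) :
    (oddModeₗ B b n h : Module.End ℂ (Fock r Q)) = oddMode B b h n := rfl

theorem evenField_ncoeff (h : ℂ ⊗[ℤ] Q) (n : ℤ) :
    (evenField B b h)[[n]] = (evenMode B b h n : Module.End ℂ (Fock r Q)) := ofModes_ncoeff _ _ n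

theorem oddField_ncoeff (h : ℂ ⊗[ℤ] Q) (n : ℤ) :
    (oddField B b h)[[n]] = (oddMode B b h n : Module.End ℂ (Fock r Q)) := ofModes_ncoeff _ _ n

/-- The field `(S h)(z)` as a linear function of `h`. -/
def evenFieldₗ : ℂ ⊗[ℤ] Q →ₗ[ℂ] VertexOperator ℂ (Fock r Q) where
  toFun := evenField B b
  map_add' h h' := vertexOperator_ext_ncoeff fun n => by
    simp only [map_add, Pi.add_apply, evenField_ncoeff]
    exact (evenModeₗ B b n).map_add h h'
  map_smul' c h := vertexOperator_ext_ncoeff fun n => by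
    simp only [map_smul, Pi.smul_apply, evenField_ncoeff]
    exact (evenModeₗ B b n).map_smul c h

/-- The field `h(z)` as a linear function of `h`. -/
def oddFieldₗ : ℂ ⊗[ℤ] Q →ₗ[ℂ] VertexOperator ℂ (Fock r Q) where
  toFun := oddField B b
  map_add' h h' := vertexOperator_ext_ncoeff fun n => by
    simp only [map_add, Pi.add_apply, oddField_ncoeff]
    exact (oddModeₗ B b n).map_add h h'
  map_smul' c h := vertexOperator_ext_ncoeff fun n => by
    simp only [map_smul, Pi.smul_apply, oddField_ncoeff]
    exact (oddModeₗ B b n).map_smul c h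

/-- Preservation of the sectors `V¹(W) ⊗ e^β`, for an operator that maps basis vectors to multiples
of basis vectors. -/
def PreservesSectors (X : Module.End ℂ (Fock r Q)) : Prop :=
  ∀ s, ∃ s' c, X (Finsupp.single s 1) = Finsupp.single s' c ∧ s'.2.2 = s.2.2

theorem preservesSectors_evenMode_zero (h : ℂ ⊗[ℤ] Q) :
    PreservesSectors (evenMode B b h 0 : Module.End ℂ (Fock r Q)) := fun s =>
  ⟨s, formW B h (toW s.2.2), by rw [evenMode_zero_single, Finsupp.smul_single_one], rfl⟩

omit [AddCommGroup Q] in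
theorem preservesSectors_evenCreate (k : ModeIdx r) :
    PreservesSectors (evenCreate k : Module.End ℂ (Fock r Q)) := fun s =>
  ⟨_, _, evenCreate_single k s 1, rfl⟩

omit [AddCommGroup Q] in
theorem preservesSectors_evenDeriv (k : ModeIdx r) :
    PreservesSectors (evenDeriv k : Module.End ℂ (Fock r Q)) := fun s =>
  ⟨_, _, evenDeriv_single k s 1, rfl⟩

omit [AddCommGroup Q] in
theorem preservesSectors_oddCreate (k : ModeIdx r) :
    PreservesSectors (oddCreate k : Module.End ℂ (Fock r Q)) := fun s => by
  rw [oddCreate_single]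
  split_ifs
  · exact ⟨s, 0, (Finsupp.single_zero s).symm, rfl⟩
  · exact ⟨_, _, rfl, rfl⟩

omit [AddCommGroup Q] in
theorem preservesSectors_oddDeriv (k : ModeIdx r) :
    PreservesSectors (oddDeriv k : Module.End ℂ (Fock r Q)) := fun s => by
  rw [oddDeriv_single]
  split_ifs
  · exact ⟨_, _, rfl, rfl⟩
  · exact ⟨s, 0, (Finsupp.single_zero s).symm, rfl⟩

variable {B b} in
theorem PreservesSectors.commute_evenMode_zero {X : Module.End ℂ (Fock r Q)}
    (hX : PreservesSectors X) (h : ℂ ⊗[ℤ] Q) : Commute (evenMode B b h 0) X := by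
  refine end_ext_single fun s => ?_
  obtain ⟨s', c, hXs, hβ⟩ := hX s
  rw [Module.End.mul_apply, Module.End.mul_apply, evenMode_zero_single, map_smul, hXs,
    evenMode_zero_single, hβ]

theorem evenMode_zero_commute_evenMode (h h' : ℂ ⊗[ℤ] Q) (n : ℤ) :
    Commute (evenMode B b h 0 : Module.End ℂ (Fock r Q)) (evenMode B b h' n) := by
  rcases int_eq_zero_or_succ_or_neg n with rfl | ⟨n, rfl⟩ | ⟨n, rfl⟩
  · exact (preservesSectors_evenMode_zero B b h').commute_evenMode_zero h
  · rw [evenMode_succ]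
    exact Commute.sum_right _ _ _ fun i _ =>
      ((preservesSectors_evenDeriv _).commute_evenMode_zero h).smul_right _
  · rw [evenMode_neg]
    exact Commute.sum_right _ _ _ fun i _ =>
      ((preservesSectors_evenCreate _).commute_evenMode_zero h).smul_right _

theorem evenMode_zero_commute_oddMode (h h' : ℂ ⊗[ℤ] Q) (n : ℤ) :
    Commute (evenMode B b h 0 : Module.End ℂ (Fock r Q)) (oddMode B b h' n) := by
  rcases int_eq_natCast_or_neg n with ⟨n, rfl⟩ | ⟨n, rfl⟩
  · exact Commute.sum_right _ _ _ fun i _ =>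
      ((preservesSectors_oddDeriv _).commute_evenMode_zero h).smul_right _
  · rw [oddMode_neg]
    exact Commute.sum_right _ _ _ fun i _ =>
      ((preservesSectors_oddCreate _).commute_evenMode_zero h).smul_right _

theorem evenMode_commute_oddMode (h h' : ℂ ⊗[ℤ] Q) (m n : ℤ) :
    Commute (evenMode B b h m : Module.End ℂ (Fock r Q)) (oddMode B b h' n) := by
  rcases int_eq_zero_or_succ_or_neg m with rfl | ⟨m, rfl⟩ | ⟨m, rfl⟩
  · exact evenMode_zero_commute_oddMode B b h h' n
  all_goals
    rcases int_eq_natCast_or_neg n with ⟨n, rfl⟩ | ⟨n, rfl⟩ <;>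
    simp only [evenMode_succ, evenMode_neg, oddMode_neg, oddMode_natCast]
  · exact Commute.sum_left _ _ _ fun i _ => Commute.sum_right _ _ _ fun j _ =>
      ((evenDeriv_commute_oddDeriv _ _).smul_right _).smul_left _
  · exact Commute.sum_left _ _ _ fun i _ => Commute.sum_right _ _ _ fun j _ =>
      ((evenDeriv_commute_oddCreate _ _).smul_right _).smul_left _
  · exact Commute.sum_left _ _ _ fun i _ => Commute.sum_right _ _ _ fun j _ =>
      ((evenCreate_commute_oddDeriv _ _).smul_right _).smul_left _
  · exact Commute.sum_left _ _ _ fun i _ => Commute.sum_right _ _ _ fun j _ =>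
      ((evenCreate_commute_oddCreate _ _).smul_right _).smul_left _

theorem superBracket_evenMode_succ_neg (h h' : ℂ ⊗[ℤ] Q) (m n : ℕ) :
    superBracket (1 : ℂ) (evenMode B b h ((m : ℤ) + 1) : Module.End ℂ (Fock r Q))
        (evenMode B b h' (-(n : ℤ) - 1)) =
      if n = m then (((m : ℂ) + 1) * formW B h h') • 1 else 0 := by
  rw [evenMode_succ, evenMode_neg, superBracket_sum_smul_eq_smul (c := if n = m then 1 else 0)]
  · simp only [mul_assoc, ← Finset.mul_sum, sum_formW_mul_coordW, smul_ite, smul_zero]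
  · intro i j
    rw [superBracket_evenDeriv_evenCreate, ← ite_and]
    exact if_congr (by simp [and_comm, eq_comm]) rfl rfl

theorem superBracket_oddMode_natCast_neg (h h' : ℂ ⊗[ℤ] Q) (m n : ℕ) :
    superBracket (-1 : ℂ) (oddMode B b h (m : ℤ) : Module.End ℂ (Fock r Q))
        (oddMode B b h' (-(n : ℤ) - 1)) = if n = m then formW B h h' • 1 else 0 := by
  rw [oddMode_natCast, oddMode_neg, superBracket_sum_smul_eq_smul (c := if n = m then 1 else 0)]
  · simp only [sum_formW_mul_coordW, smul_ite, smul_zero]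
  · intro i j
    rw [superBracket_oddDeriv_oddCreate, ← ite_and]
    exact if_congr (by simp [and_comm, eq_comm]) rfl rfl

variable {B} (hB : B.IsSymm)
include hB

theorem superBracket_evenMode_evenMode (h h' : ℂ ⊗[ℤ] Q) (m n : ℤ) :
    superBracket (1 : ℂ) (evenMode B b h m : Module.End ℂ (Fock r Q)) (evenMode B b h' n) =
      if n = -m then ((m : ℂ) * formW B h h') • 1 else 0 := by
  rcases int_eq_zero_or_succ_or_neg m with rfl | ⟨m, rfl⟩ | ⟨m, rfl⟩
  · rw [superBracket_one_eq_zero_iff.2 (evenMode_zero_commute_evenMode B b h h' n)]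
    simp
  all_goals rcases int_eq_zero_or_succ_or_neg n with rfl | ⟨n, rfl⟩ | ⟨n, rfl⟩
  · rw [if_neg (by omega), superBracket_one_eq_zero_iff]
    exact (evenMode_zero_commute_evenMode B b h' h _).symm
  · rw [if_neg (by omega), superBracket_one_eq_zero_iff, evenMode_succ, evenMode_succ]
    exact Commute.sum_left _ _ _ fun i _ => Commute.sum_right _ _ _ fun j _ =>
      ((evenDeriv_commute _ _).smul_right _).smul_left _
  · rw [superBracket_evenMode_succ_neg]
    exact if_congr (by omega) (by push_cast; rfl) rfl
  · rw [if_neg (by omega), superBracket_one_eq_zero_iff]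
    exact (evenMode_zero_commute_evenMode B b h' h _).symm
  · rw [superBracket_comm (one_mul 1), superBracket_evenMode_succ_neg, formW_symm hB h' h]
    rcases eq_or_ne m n with rfl | hne
    · rw [if_pos rfl, if_pos (by ring)]
      push_cast
      module
    · rw [if_neg hne, if_neg (by omega), smul_zero]
  · rw [if_neg (by omega), superBracket_one_eq_zero_iff, evenMode_neg, evenMode_neg]
    exact Commute.sum_left _ _ _ fun i _ => Commute.sum_right _ _ _ fun j _ =>
      ((evenCreate_commute _ _).smul_right _).smul_left _

theorem superBracket_oddMode_oddMode (h h' : ℂ ⊗[ℤ] Q) (m n : ℤ) :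
    superBracket (-1 : ℂ) (oddMode B b h m : Module.End ℂ (Fock r Q)) (oddMode B b h' n) =
      if n = -m - 1 then formW B h h' • 1 else 0 := by
  rcases int_eq_natCast_or_neg m with ⟨m, rfl⟩ | ⟨m, rfl⟩ <;>
  rcases int_eq_natCast_or_neg n with ⟨n, rfl⟩ | ⟨n, rfl⟩
  · rw [if_neg (by omega), oddMode_natCast, oddMode_natCast, superBracket_sum_smul]
    simp only [superBracket_oddDeriv_oddDeriv, smul_zero, Finset.sum_const_zero]
  · rw [superBracket_oddMode_natCast_neg]
    exact if_congr (by omega) rfl rfl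
  · rw [superBracket_comm (by norm_num), superBracket_oddMode_natCast_neg, neg_neg, one_smul,
      formW_symm hB h' h]
    exact if_congr (by omega) rfl rfl
  · rw [if_neg (by omega), oddMode_neg, oddMode_neg, superBracket_sum_smul]
    simp only [superBracket_oddCreate_oddCreate, smul_zero, Finset.sum_const_zero]

end ModeRelations

/-! ### The modes of the superfield of `G` -/

section DualBases

variable {R M N κ : Type*} [CommSemiring R] [AddCommMonoid M] [Module R M] [AddCommMonoid N]
  [Module R N] [Fintype κ] [DecidableEq κ] {F : LinearMap.BilinForm R M}

theorem sum_smul_map_of_dual {a : Module.Basis κ R M} {a' : κ → M}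
    (hdual : ∀ i j, F (a i) (a' j) = if i = j then 1 else 0) (f : M →ₗ[R] N) (x : M) :
    ∑ i, F x (a' i) • f (a i) = f x := by
  have hrepr (i : κ) : F x (a' i) = a.repr x i := by
    conv_lhs => rw [← a.sum_repr x]
    simp only [map_sum, map_smul, LinearMap.sum_apply, LinearMap.smul_apply, hdual]
    simp
  simp only [hrepr, ← map_smul, ← map_sum, a.sum_repr]

omit [Fintype κ] in
theorem dual_symm (hF : ∀ x y, F x y = F y x) {a a' : κ → M}
    (hdual : ∀ i j, F (a i) (a' j) = if i = j then 1 else 0) (i j : κ) :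
    F (a' i) (a j) = if i = j then 1 else 0 := by
  rw [hF, hdual]
  exact if_congr eq_comm rfl rfl

theorem sum_map₂_swap_of_dual (hF : ∀ x y, F x y = F y x) {a a' : Module.Basis κ R M}
    (hdual : ∀ i j, F (a i) (a' j) = if i = j then 1 else 0) (f : M →ₗ[R] M →ₗ[R] N) :
    ∑ i, f (a i) (a' i) = ∑ i, f (a' i) (a i) := by
  calc ∑ i, f (a i) (a' i) = ∑ i, ∑ j, F (a' i) (a' j) • f (a i) (a j) :=
        Finset.sum_congr rfl fun i _ => (sum_smul_map_of_dual hdual (f (a i)) (a' i)).symm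
    _ = ∑ j, ∑ i, F (a' j) (a' i) • f.flip (a j) (a i) := by
        rw [Finset.sum_comm]
        simp only [hF (a' _) (a' _), LinearMap.flip_apply]
    _ = ∑ j, f (a' j) (a j) :=
        Finset.sum_congr rfl fun j _ => sum_smul_map_of_dual hdual (f.flip (a j)) (a' j)

end DualBases

section SuperfieldModes

open scoped VertexOperator

open Filter

variable {r : ℕ} {Q : Type*} [AddCommGroup Q]
  (B : LinearMap.BilinForm ℤ Q) (b : Module.Basis (Fin r) ℤ Q)

/-- The modes of the field `∑ᵢ :(S αᵢ)(z) αⁱ(z):`, for two families `a`, `a'` in `W`. -/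
def modeG {κ : Type*} [Fintype κ] (a a' : κ → ℂ ⊗[ℤ] Q) (n : ℤ) : Module.End ℂ (Fock r Q) :=
  ∑ i, nopMode 1 (evenField B b (a i)) (oddField B b (a' i)) n

variable {κ : Type*} [Fintype κ] [DecidableEq κ] {B} (hB : B.IsSymm)
  {a a' : Module.Basis κ ℂ (ℂ ⊗[ℤ] Q)}
  (hdual : ∀ i j, formW B (a i) (a' j) = if i = j then 1 else 0)
include hB hdual

theorem superBracket_evenMode_modeG (h : ℂ ⊗[ℤ] Q) (m n : ℤ) :
    superBracket (1 : ℂ) (evenMode B b h m) (modeG B b a a' n : Module.End ℂ (Fock r Q)) =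
      (m : ℂ) • oddMode B b h (n - 1 + m) := by
  have hterm (i : κ) : superBracket (1 : ℂ) (evenMode B b h m : Module.End ℂ (Fock r Q))
      (nopMode 1 (evenField B b (a i)) (oddField B b (a' i)) n) =
      formW B h (a i) • (m : ℂ) • oddModeₗ B b (n - 1 + m) (a' i) := by
    have hder := superBracket_nopMode (X := evenMode B b h m) (s := 1) (t := 1)
      (A := evenField B b (a i)) (B := oddField B b (a' i))
      (A' := constField (Fock r Q) (-m) ((m : ℂ) * formW B h (a i))) (B' := 0) 1 (one_mul 1)
      (fun j => by rw [evenField_ncoeff, constField_ncoeff, superBracket_evenMode_evenMode b hB])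
      (fun j => by
        rw [oddField_ncoeff, superBracket_one_eq_zero_iff.2 (evenMode_commute_oddMode B b _ _ _ _),
          map_zero, Pi.zero_apply]) n
    simp only [one_mul, nopMode_constField_left, nopMode_zero_right, oddField_ncoeff] at hder
    rw [hder, oddModeₗ_apply, sub_neg_eq_add]
    module
  rw [modeG, map_sum, Finset.sum_congr rfl fun i _ => hterm i]
  exact sum_smul_map_of_dual (dual_symm (formW_symm hB) hdual)
    ((m : ℂ) • oddModeₗ B b (n - 1 + m)) h

theorem superBracket_oddMode_modeG (h : ℂ ⊗[ℤ] Q) (m n : ℤ) :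
    superBracket (-1 : ℂ) (oddMode B b h m) (modeG B b a a' n : Module.End ℂ (Fock r Q)) =
      evenMode B b h (n + m) := by
  have hterm (i : κ) : superBracket (-1 : ℂ) (oddMode B b h m : Module.End ℂ (Fock r Q))
      (nopMode 1 (evenField B b (a i)) (oddField B b (a' i)) n) =
      formW B h (a' i) • evenModeₗ B b (n + m) (a i) := by
    have hder := superBracket_nopMode (X := oddMode B b h m) (s := 1) (t := -1)
      (A := evenField B b (a i)) (B := oddField B b (a' i)) (A' := 0)
      (B' := constField (Fock r Q) (-m - 1) (formW B h (a' i))) 1 (one_mul 1)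
      (fun j => by
        rw [evenField_ncoeff, map_zero, Pi.zero_apply,
          superBracket_one_eq_zero_iff.2 (evenMode_commute_oddMode B b _ _ _ _).symm])
      (fun j => by rw [oddField_ncoeff, constField_ncoeff, superBracket_oddMode_oddMode b hB]) n
    simp only [one_mul, nopMode_constField_right, nopMode_zero_left, evenField_ncoeff, ite_self,
      zero_add, one_smul] at hder
    rw [hder, evenModeₗ_apply, show n - 1 - (-m - 1) = n + m by ring]
  rw [modeG, map_sum, Finset.sum_congr rfl fun i _ => hterm i]
  exact sum_smul_map_of_dual hdual (evenModeₗ B b (n + m)) h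

theorem sum_evenMode_neg_mul_oddMode (j : ℕ) :
    ∑ i, (evenMode B b (a i) (-(j : ℤ) - 1) * oddMode B b (a' i) (j : ℤ) :
        Module.End ℂ (Fock r Q)) =
      ∑ l, evenCreate (toLex (j, l)) * oddDeriv (toLex (j, l)) := by
  simp only [oddMode_natCast, Finset.mul_sum, mul_smul_comm]
  rw [Finset.sum_comm]
  refine Finset.sum_congr rfl fun l _ => ?_
  simp only [← smul_mul_assoc, ← Finset.sum_mul, formW_symm hB _ (toW (b l))]
  rw [← evenMode_basis_neg B b l j]
  exact congrArg (· * _) (sum_smul_map_of_dual hdual (evenModeₗ B b _) (toW (b l)))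

theorem sum_oddMode_neg_mul_evenMode_succ (j : ℕ) :
    ∑ i, (oddMode B b (a' i) (-(j + 1 : ℕ) - 1) * evenMode B b (a i) ((j : ℤ) + 1) :
        Module.End ℂ (Fock r Q)) =
      ∑ l, ((j : ℂ) + 1) • (oddCreate (toLex (j + 1, l)) * evenDeriv (toLex (j, l))) := by
  simp only [evenMode_succ, Finset.mul_sum, mul_smul_comm, mul_smul]
  rw [Finset.sum_comm]
  refine Finset.sum_congr rfl fun l _ => ?_
  simp only [← smul_mul_assoc, ← Finset.smul_sum, ← Finset.sum_mul, formW_symm hB _ (toW (b l))]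
  rw [← oddMode_basis_neg B b l (j + 1)]
  exact congrArg (((j : ℂ) + 1) • · * _)
    (sum_smul_map_of_dual (dual_symm (formW_symm hB) hdual) (oddModeₗ B b _) (toW (b l)))

theorem sum_oddMode_evenMode_zero_single (n : ℤ) (s : FockIdx r Q) :
    ∑ i, oddMode B b (a' i) n (evenMode B b (a i) 0 (Finsupp.single s 1)) =
      oddMode B b (toW s.2.2) n (Finsupp.single s 1) := by
  simp only [evenMode_zero_single, map_smul, formW_symm hB _ (toW s.2.2)]
  exact sum_smul_map_of_dual (dual_symm (formW_symm hB) hdual)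
    ((oddModeₗ B b n).flip (Finsupp.single s 1)) (toW s.2.2)

omit hB hdual in
theorem eventually_sum_range_sum_eq {M : Type*} [AddCommMonoid M] {f : ModeIdx r → M}
    {t : Finset (ModeIdx r)} (hf : ∀ k ∉ t, f k = 0) :
    ∀ᶠ N in atTop, ∑ j ∈ Finset.range N, ∑ l, f (toLex (j, l)) = ∑ k ∈ t, f k := by
  obtain ⟨K, hK⟩ := exists_bound t
  filter_upwards [eventually_ge_atTop K] with N hN
  rw [← Finset.sum_product']
  refine (Finset.sum_map (Finset.range N ×ˢ Finset.univ)
    (toLex (α := ℕ × Fin r)).toEmbedding f).symm.trans ?_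
  refine (Finset.sum_subset (fun k hk => Finset.mem_map.2 ⟨ofLex k, ?_, rfl⟩)
    fun k _ hk => hf k hk).symm
  simpa using (hK k hk).trans_le hN

theorem eventually_modeG_zero_single (s : FockIdx r Q) :
    ∀ᶠ N in atTop, modeG B b a a' 0 (Finsupp.single s 1) =
      (∑ j ∈ Finset.range (N + 1), ∑ l,
        evenCreate (toLex (j, l)) (oddDeriv (toLex (j, l)) (Finsupp.single s 1))) +
      ((∑ j ∈ Finset.range N, ∑ l, ((j : ℂ) + 1) •
        oddCreate (toLex (j + 1, l)) (evenDeriv (toLex (j, l)) (Finsupp.single s 1))) +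
      oddMode B b (toW s.2.2) (-1) (Finsupp.single s 1)) := by
  have hnop := eventually_all.2 fun i => (tendsto_add_atTop_nat 1).eventually
    (eventually_nopMode_apply 1 (evenField B b (a i)) (oddField B b (a' i)) 0 (Finsupp.single s 1))
  filter_upwards [hnop] with N hN
  simp only [modeG, LinearMap.sum_apply, hN, evenField_ncoeff, oddField_ncoeff, zero_add, one_smul,
    Finset.sum_add_distrib, zero_sub]
  refine congrArg₂ (· + ·) ?_ ?_
  · rw [Finset.sum_comm]
    refine Finset.sum_congr rfl fun j _ => ?_
    simpa using LinearMap.congr_fun (sum_evenMode_neg_mul_oddMode (Q := Q) b hB hdual j) _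
  · rw [Finset.sum_comm, Finset.sum_range_succ']
    refine congrArg₂ (· + ·) (Finset.sum_congr rfl fun j _ => ?_) ?_
    · simpa using LinearMap.congr_fun (sum_oddMode_neg_mul_evenMode_succ (Q := Q) b hB hdual j) _
    · exact sum_oddMode_evenMode_zero_single b hB hdual (-1) s

theorem modeG_zero : modeG B b a a' 0 = (opS B b : Module.End ℂ (Fock r Q)) := by
  refine end_ext_single fun s => ?_
  have hodd := eventually_sum_range_sum_eq (t := s.2.1)
    (f := fun k => evenCreate k (oddDeriv k (Finsupp.single s 1))) fun k hk => by
      rw [oddDeriv_eq_zero s k hk, map_zero]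
  have heven := eventually_sum_range_sum_eq (t := s.1.support)
    (f := fun k => (((ofLex k).1 : ℂ) + 1) • oddCreate (toLex ((ofLex k).1 + 1, (ofLex k).2))
      (evenDeriv k (Finsupp.single s 1))) fun k hk => by
      rw [evenDeriv_eq_zero s k (Finsupp.notMem_support_iff.1 hk), map_zero, smul_zero]
  obtain ⟨N, hN, hoddN, hevenN⟩ := ((eventually_modeG_zero_single b hB hdual s).and
    (((tendsto_add_atTop_nat 1).eventually hodd).and heven)).exists
  simp only [ofLex_toLex] at hevenN
  rw [hN, hoddN, hevenN, opS, onBasis_single, ← add_assoc]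
  exact congrArg (· + _) (add_comm _ _)

omit [Fintype κ] in
theorem superBracket_opS_evenMode [Finite κ] (h : ℂ ⊗[ℤ] Q) (m : ℤ) :
    superBracket (1 : ℂ) (opS B b) (evenMode B b h m : Module.End ℂ (Fock r Q)) =
      (-(m : ℂ)) • oddMode B b h (m - 1) := by
  have := Fintype.ofFinite κ
  rw [superBracket_comm (one_mul 1), ← modeG_zero b hB hdual,
    superBracket_evenMode_modeG b hB hdual, zero_sub, neg_add_eq_sub]
  module

omit [Fintype κ] in
theorem superBracket_opS_oddMode [Finite κ] (h : ℂ ⊗[ℤ] Q) (m : ℤ) :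
    superBracket (-1 : ℂ) (opS B b) (oddMode B b h m : Module.End ℂ (Fock r Q)) =
      evenMode B b h m := by
  have := Fintype.ofFinite κ
  rw [superBracket_comm (by norm_num), ← modeG_zero b hB hdual,
    superBracket_oddMode_modeG b hB hdual, neg_neg, one_smul, zero_add]

end SuperfieldModes

/-! ### The modes of the superfield of `S G` -/

section SuperVirasoro

open scoped VertexOperator

variable {r : ℕ} {Q : Type*} [AddCommGroup Q]
  (B : LinearMap.BilinForm ℤ Q) (b : Module.Basis (Fin r) ℤ Q)

/-- The modes of the superfield of `S G`, written as the anticommutators of `S` with the modes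
of the superfield of `G`. -/
def modeL {κ : Type*} [Fintype κ] (a a' : κ → ℂ ⊗[ℤ] Q) (n : ℤ) : Module.End ℂ (Fock r Q) :=
  superBracket (-1 : ℂ) (opS B b) (modeG B b a a' n)

variable {B} (hB : B.IsSymm)
include hB

theorem nopMode_evenField_comm (h h' : ℂ ⊗[ℤ] Q) (n : ℤ) :
    nopMode 1 (evenField B b h) (evenField B b h') n =
      nopMode 1 (evenField B b h') (evenField B b h) n := by
  refine nopMode_swap fun j => ?_
  rw [evenField_ncoeff, evenField_ncoeff]
  refine Or.imp_right (superBracket_one_eq_zero_iff (R := ℂ) (A := Module.End ℂ (Fock r Q))).1 ?_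
  rw [superBracket_evenMode_evenMode b hB]
  by_cases hn : n = 1 ∧ j ≠ 0
  · left
    omega
  · right
    split_ifs with hj
    · obtain rfl : j = 0 := by omega
      simp
    · rfl

variable {κ : Type*} [Fintype κ] [DecidableEq κ]
  {a a' : Module.Basis κ ℂ (ℂ ⊗[ℤ] Q)}
  (hdual : ∀ i j, formW B (a i) (a' j) = if i = j then 1 else 0)
include hdual

theorem modeL_eq_sum_nopMode (n : ℤ) :
    modeL B b a a' n = ∑ i, (nopMode 1 (evenField B b (a i)) (evenField B b (a' i)) n -
      nopMode (-1) (oddField B b (a' i)) (fieldDeriv (oddField B b (a i))) n) := by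
  rw [modeL, modeG, map_sum]
  refine Finset.sum_congr rfl fun i _ => ?_
  have hswap : nopMode 1 (evenField B b (a i)) (oddField B b (a' i)) n =
      nopMode 1 (oddField B b (a' i)) (evenField B b (a i)) n :=
    nopMode_swap fun j => Or.inr <| by
      rw [evenField_ncoeff, oddField_ncoeff]
      exact evenMode_commute_oddMode B b _ _ _ _
  have hder := superBracket_nopMode (X := opS B b) (s := -1) (t := 1)
    (A := oddField B b (a' i)) (B := evenField B b (a i))
    (A' := evenField B b (a' i)) (B' := fieldDeriv (oddField B b (a i))) 1 (by norm_num)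
    (fun j => by
      rw [oddField_ncoeff, evenField_ncoeff, superBracket_opS_oddMode b hB hdual])
    (fun j => by
      rw [evenField_ncoeff, fieldDeriv_ncoeff, oddField_ncoeff,
        superBracket_opS_evenMode b hB hdual]) n
  simp only [one_mul, mul_one] at hder
  rw [hswap, hder, nopMode_evenField_comm b hB]
  module

theorem superBracket_modeL_evenMode (h : ℂ ⊗[ℤ] Q) (m n : ℤ) :
    superBracket (1 : ℂ) (modeL B b a a' n) (evenMode B b h m : Module.End ℂ (Fock r Q)) =
      (-(2 * m : ℂ)) • evenMode B b h (n - 1 + m) := by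
  rw [modeL, superBracket_one_anticommutator_even, superBracket_comm (one_mul 1) (evenMode B b h m),
    superBracket_evenMode_modeG b hB hdual, superBracket_opS_evenMode b hB hdual]
  simp only [map_smul, LinearMap.smul_apply, superBracket_opS_oddMode b hB hdual,
    superBracket_oddMode_modeG b hB hdual, show n + (m - 1) = n - 1 + m by ring]
  module

theorem superBracket_modeL_oddMode (h : ℂ ⊗[ℤ] Q) (m n : ℤ) :
    superBracket (1 : ℂ) (modeL B b a a' n) (oddMode B b h m : Module.End ℂ (Fock r Q)) =
      (-(n + 2 * m : ℂ)) • oddMode B b h (n - 1 + m) := by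
  rw [modeL, superBracket_one_anticommutator_odd,
    superBracket_comm (by norm_num) (oddMode B b h m), superBracket_oddMode_modeG b hB hdual,
    superBracket_opS_oddMode b hB hdual, superBracket_evenMode_modeG b hB hdual, neg_neg, one_smul,
    superBracket_opS_evenMode b hB hdual, show n + m - 1 = n - 1 + m by ring]
  push_cast
  module

end SuperVirasoro

/-! ### The ground vectors `1 ⊗ e^β` -/

section GroundVectors

open scoped VertexOperator

variable {r : ℕ} {Q : Type*} [AddCommGroup Q]
  (B : LinearMap.BilinForm ℤ Q) (b : Module.Basis (Fin r) ℤ Q)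

theorem evenMode_ground_of_pos (h : ℂ ⊗[ℤ] Q) {n : ℤ} (hn : 0 < n) (β : Q) (x : ℂ) :
    evenMode B b h n (Finsupp.single (0, ∅, β) x) = 0 := by
  obtain ⟨m, rfl⟩ : ∃ m : ℕ, n = m + 1 := ⟨(n - 1).toNat, by omega⟩
  simp [evenMode_succ, evenDeriv_single]

theorem oddMode_ground_of_nonneg (h : ℂ ⊗[ℤ] Q) {n : ℤ} (hn : 0 ≤ n) (β : Q) (x : ℂ) :
    oddMode B b h n (Finsupp.single (0, ∅, β) x) = 0 := by
  lift n to ℕ using hn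
  simp [oddMode_natCast, oddDeriv_single]

theorem opS_ground (β : Q) (x : ℂ) :
    opS B b (Finsupp.single (0, ∅, β) x) =
      oddMode B b (toW β) (-1) (Finsupp.single (0, ∅, β) x) := by
  rw [opS, onBasis_single_smul, ← Finsupp.smul_single_one _ x, map_smul]
  simp

theorem modeG_ground_of_pos {κ : Type*} [Fintype κ] (a a' : κ → ℂ ⊗[ℤ] Q) {n : ℤ} (hn : 0 < n)
    (β : Q) (x : ℂ) : modeG B b a a' n (Finsupp.single (0, ∅, β) x) = 0 := by
  rw [modeG, LinearMap.sum_apply]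
  refine Finset.sum_eq_zero fun i _ => ?_
  rw [nopMode_apply]
  simp only [evenField_ncoeff, oddField_ncoeff]
  rw [finsum_eq_zero_of_forall_eq_zero fun j => by
      rw [oddMode_ground_of_nonneg B b _ (by omega), map_zero],
    finsum_eq_zero_of_forall_eq_zero fun j => ?_, smul_zero, add_zero]
  rcases j.eq_zero_or_pos with rfl | hj
  · rw [Nat.cast_zero, evenMode_zero_single, map_smul, oddMode_ground_of_nonneg B b _ (by omega),
      smul_zero]
  · rw [evenMode_ground_of_pos B b _ (by omega), map_zero]

theorem modeL_ground_of_pos {B} (hB : B.IsSymm) {κ : Type*} [Fintype κ] [DecidableEq κ]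
    {a a' : Module.Basis κ ℂ (ℂ ⊗[ℤ] Q)}
    (hdual : ∀ i j, formW B (a i) (a' j) = if i = j then 1 else 0) {n : ℤ} (hn : 0 < n)
    (β : Q) (x : ℂ) :
    modeL B b a a' n (Finsupp.single (0, ∅, β) x) =
      evenMode B b (toW β) (n - 1) (Finsupp.single (0, ∅, β) x) := by
  have hbracket := superBracket_oddMode_modeG b hB hdual (toW β) (-1) n
  rw [superBracket_apply] at hbracket
  have hground := LinearMap.congr_fun hbracket (Finsupp.single (0, ∅, β) x)
  rw [modeL, superBracket_apply]
  simp only [LinearMap.sub_apply, LinearMap.smul_apply, Module.End.mul_apply, opS_ground,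
    modeG_ground_of_pos B b _ _ hn, map_zero, zero_sub, neg_smul, one_smul, neg_neg] at hground ⊢
  rw [hground, sub_eq_add_neg]

end GroundVectors

/-! ### The state-field correspondence on quadratic states -/

section StateField

open scoped VertexOperator

theorem dividedDeriv_zero {r : ℕ} {Q : Type*} (A : VertexOperator ℂ (Fock r Q)) :
    dividedDeriv 0 A = A := by
  rw [dividedDeriv, Nat.factorial_zero, Nat.cast_one, inv_one]
  exact one_smul ℂ A

theorem dividedDeriv_one {r : ℕ} {Q : Type*} (A : VertexOperator ℂ (Fock r Q)) :
    dividedDeriv 1 A = fieldDeriv A := by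
  rw [dividedDeriv, Nat.factorial_one, Nat.cast_one, inv_one]
  exact one_smul ℂ (fieldDeriv A)

theorem units_inv_smul_smul {V : Type*} [AddCommGroup V] [Module ℂ V] (u : ℂˣ)
    (A : VertexOperator ℂ V) : (u : ℂ)⁻¹ • (u : ℂ) • A = A :=
  inv_smul_smul₀ u.ne_zero A

variable {r : ℕ} {Q : Type*} [AddCommGroup Q]
  (B : LinearMap.BilinForm ℤ Q) (b : Module.Basis (Fin r) ℤ Q) {ε : Q → Q → ℂˣ}

theorem toW_zero : toW (0 : Q) = 0 := TensorProduct.tmul_zero Q (1 : ℂ)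

theorem evenMode_toW_zero (n : ℤ) :
    (evenMode B b (toW 0) n : Module.End ℂ (Fock r Q)) = 0 := by
  rw [toW_zero]
  exact map_zero (evenModeₗ B b n)

theorem oddMode_toW_zero (n : ℤ) :
    (oddMode B b (toW 0) n : Module.End ℂ (Fock r Q)) = 0 := by
  rw [toW_zero]
  exact map_zero (oddModeₗ B b n)

theorem expSeries_zero {R : Type*} [Ring R] [Module ℂ R] :
    expSeries (0 : PowerSeries R) = 1 := by
  ext n
  rw [expSeries, PowerSeries.coeff_mk, Finset.sum_range_succ']
  simp

theorem expMinus_zero : (expMinus B b 0 : PowerSeries (Module.End ℂ (Fock r Q))) = 1 := by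
  rw [expMinus]
  refine Eq.trans (congrArg expSeries ?_) expSeries_zero
  ext1 n
  rw [PowerSeries.coeff_mk, evenMode_toW_zero, smul_zero, map_zero]

theorem expPlus_zero : (expPlus B b 0 : PowerSeries (Module.End ℂ (Fock r Q))) = 1 := by
  rw [expPlus]
  refine Eq.trans (congrArg expSeries ?_) expSeries_zero
  ext1 n
  rw [PowerSeries.coeff_mk, evenMode_toW_zero, smul_zero, map_zero]

theorem cocycle_zero_left (hε : ∀ α β γ : Q, ε α β * ε (α + β) γ = ε β γ * ε α (β + γ)) (β : Q) :
    ε 0 β = ε 0 0 := by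
  have hzero := hε 0 0 β
  rw [zero_add, zero_add] at hzero
  exact (mul_right_cancel hzero).symm

variable (hε : ∀ β, ε 0 β = ε 0 0)
include hε

theorem gammaField_zero : gammaField B b ε 0 = constField (Fock r Q) (-1) (ε 0 0) := by
  refine vertexOperator_ext_ncoeff fun n => ?_
  rw [gammaField, ofModes_ncoeff, constField_ncoeff]
  refine end_ext_single fun s => ?_
  rw [gammaMode, onBasis_single, finsum_eq_single _ 0 fun q hq => by
    rw [expPlus_zero, PowerSeries.coeff_one, if_neg hq, LinearMap.zero_apply, map_zero, map_zero],
    expPlus_zero, PowerSeries.coeff_zero_one, Module.End.one_apply, expMinusCoeff, expMinus_zero,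
    PowerSeries.coeff_one]
  simp only [Nat.cast_zero, zero_sub, map_zero, LinearMap.zero_apply, sub_zero]
  by_cases hn : n = -1
  · subst hn
    simp [expMul, onBasis_single_smul, hε s.2.2]
  · rw [if_neg hn]
    split_ifs <;> first | omega | simp

omit hε in
theorem vQ_Y_single (s : FockIdx r Q) (c : ℂ) :
    (vQ B b ε).Y (Finsupp.single s c) =
      c • evenPart B b (oddPart B b ε s.2.2 (s.2.1.sort (· ≤ ·)))
        ((Finsupp.toMultiset s.1).sort (· ≤ ·)) := by
  simp [vQ]

omit hε in
theorem linearMap₂_ext_toW {N : Type*} [AddCommGroup N] [Module ℂ N]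
    {f g : ℂ ⊗[ℤ] Q →ₗ[ℂ] ℂ ⊗[ℤ] Q →ₗ[ℂ] N}
    (hfg : ∀ l m, f (toW (b l)) (toW (b m)) = g (toW (b l)) (toW (b m))) : f = g :=
  LinearMap.ext_basis (Algebra.TensorProduct.basis ℂ b) (Algebra.TensorProduct.basis ℂ b)
    fun l m => by simpa only [Algebra.TensorProduct.basis_apply, toW] using hfg l m

omit hε in
theorem evenMode_basis_neg_one (l : Fin r) :
    evenMode B b (toW (b l)) (-1) = (evenCreate (toLex (0, l)) : Module.End ℂ (Fock r Q)) :=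
  evenMode_basis_neg B b l 0

omit hε in
theorem oddMode_basis_neg_one (l : Fin r) :
    oddMode B b (toW (b l)) (-1) = (oddCreate (toLex (0, l)) : Module.End ℂ (Fock r Q)) :=
  oddMode_basis_neg B b l 0

omit hε in
theorem opS_stateW (h : ℂ ⊗[ℤ] Q) :
    opS B b (stateW B b ε h) = evenMode B b h (-1) (vacuum ε) := by
  refine LinearMap.congr_fun (f := opS B b ∘ₗ (oddModeₗ B b (-1)).flip (vacuum ε))
    (g := (evenModeₗ B b (-1)).flip (vacuum ε)) ((Algebra.TensorProduct.basis ℂ b).ext fun l => ?_)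
    h
  rw [Algebra.TensorProduct.basis_apply]
  change opS B b (oddMode B b (toW (b l)) (-1) (vacuum ε)) =
    evenMode B b (toW (b l)) (-1) (vacuum ε)
  rw [oddMode_basis_neg_one, evenMode_basis_neg_one, vacuum, oddCreate_single,
    if_neg (Finset.notMem_empty _), evenCreate_single, opS, onBasis_single_smul]
  dsimp only
  rw [oddMode_toW_zero]
  simp [oddDeriv_single, evenCreate_single, oddSign, Finset.filter_singleton]

theorem vQ_Y_evenMode_vacuum (h : ℂ ⊗[ℤ] Q) :
    (vQ B b ε).Y (evenMode B b h (-1) (vacuum ε)) = evenField B b h := by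
  refine LinearMap.congr_fun (f := (vQ B b ε).Y ∘ₗ (evenModeₗ B b (-1)).flip (vacuum ε))
    (g := evenFieldₗ B b) ((Algebra.TensorProduct.basis ℂ b).ext fun l => ?_) h
  rw [Algebra.TensorProduct.basis_apply]
  change (vQ B b ε).Y (evenMode B b (toW (b l)) (-1) (vacuum ε)) = evenField B b (toW (b l))
  rw [evenMode_basis_neg_one, vacuum, evenCreate_single, vQ_Y_single]
  simp [evenPart, oddPart, dividedDeriv_zero, gammaField_zero B b hε, nop_one_constField_right,
    units_inv_smul_smul]

theorem vQ_Y_evenMode_oddMode_vacuum (h h' : ℂ ⊗[ℤ] Q) :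
    (vQ B b ε).Y (evenMode B b h (-1) (oddMode B b h' (-1) (vacuum ε))) =
      nop 1 (evenField B b h) (oddField B b h') := by
  refine LinearMap.congr_fun₂
    (f := ((evenModeₗ B b (-1)).compl₂ ((oddModeₗ B b (-1)).flip (vacuum ε))).compr₂ (vQ B b ε).Y)
    (g := (nopₗ 1).compl₁₂ (evenFieldₗ B b) (oddFieldₗ B b))
    (linearMap₂_ext_toW b fun l m => ?_) h h'
  change (vQ B b ε).Y (evenMode B b (toW (b l)) (-1) (oddMode B b (toW (b m)) (-1) (vacuum ε))) =
    nop 1 (evenField B b (toW (b l))) (oddField B b (toW (b m)))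
  rw [evenMode_basis_neg_one, oddMode_basis_neg_one, vacuum, oddCreate_single,
    if_neg (Finset.notMem_empty _), evenCreate_single, vQ_Y_single]
  simp [evenPart, oddPart, dividedDeriv_zero, gammaField_zero B b hε, nop_one_constField_right,
    nop_smul_right, units_inv_smul_smul, oddSign]

theorem vQ_Y_evenMode_evenMode_vacuum (hB : B.IsSymm) (h h' : ℂ ⊗[ℤ] Q) :
    (vQ B b ε).Y (evenMode B b h (-1) (evenMode B b h' (-1) (vacuum ε))) =
      nop 1 (evenField B b h) (evenField B b h') := by
  refine LinearMap.congr_fun₂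
    (f := ((evenModeₗ B b (-1)).compl₂ ((evenModeₗ B b (-1)).flip (vacuum ε))).compr₂ (vQ B b ε).Y)
    (g := (nopₗ 1).compl₁₂ (evenFieldₗ B b) (evenFieldₗ B b))
    (linearMap₂_ext_toW b fun l m => ?_) h h'
  change (vQ B b ε).Y (evenMode B b (toW (b l)) (-1) (evenMode B b (toW (b m)) (-1) (vacuum ε))) =
    nop 1 (evenField B b (toW (b l))) (evenField B b (toW (b m)))
  have hcomm : nop 1 (evenField B b (toW (b l))) (evenField B b (toW (b m))) =
      nop 1 (evenField B b (toW (b m))) (evenField B b (toW (b l))) :=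
    vertexOperator_ext_ncoeff fun n => by
      rw [nop_ncoeff, nop_ncoeff, nopMode_evenField_comm b hB]
  rw [evenMode_basis_neg_one, evenMode_basis_neg_one, vacuum, evenCreate_single,
    evenCreate_single, vQ_Y_single]
  simp only [zero_add, map_add, Finsupp.toMultiset_single, one_smul, Finset.sort_empty]
  rcases le_total (toLex ((0 : ℕ), m)) (toLex (0, l)) with hle | hle
  · rw [Multiset.singleton_add, Multiset.sort_cons _ _ _ (by simpa using hle), hcomm]
    simp [evenPart, oddPart, dividedDeriv_zero, gammaField_zero B b hε, nop_one_constField_right,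
      nop_smul_right, units_inv_smul_smul]
  · rw [add_comm {toLex ((0 : ℕ), m)}, Multiset.singleton_add,
      Multiset.sort_cons _ _ _ (by simpa using hle)]
    simp [evenPart, oddPart, dividedDeriv_zero, gammaField_zero B b hε, nop_one_constField_right,
      nop_smul_right, units_inv_smul_smul]

theorem vQ_Y_oddMode_oddMode_vacuum (h h' : ℂ ⊗[ℤ] Q) :
    (vQ B b ε).Y (oddMode B b h (-1) (oddMode B b h' (-2) (vacuum ε))) =
      nop (-1) (oddField B b h) (fieldDeriv (oddField B b h')) := by
  refine LinearMap.congr_fun₂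
    (f := ((oddModeₗ B b (-1)).compl₂ ((oddModeₗ B b (-2)).flip (vacuum ε))).compr₂ (vQ B b ε).Y)
    (g := (nopₗ (-1)).compl₁₂ (oddFieldₗ B b) (fieldDerivₗ ∘ₗ oddFieldₗ B b))
    (linearMap₂_ext_toW b fun l m => ?_) h h'
  change (vQ B b ε).Y (oddMode B b (toW (b l)) (-1) (oddMode B b (toW (b m)) (-2) (vacuum ε))) =
    nop (-1) (oddField B b (toW (b l))) (fieldDeriv (oddField B b (toW (b m))))
  have hlt : toLex ((0 : ℕ), l) < toLex (1, m) := Prod.Lex.toLex_lt_toLex.2 (Or.inl zero_lt_one)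
  rw [oddMode_basis_neg_one, show (-2 : ℤ) = -((1 : ℕ) : ℤ) - 1 by norm_num, oddMode_basis_neg,
    vacuum, oddCreate_single, if_neg (Finset.notMem_empty _), oddCreate_single,
    if_neg (by simp), vQ_Y_single]
  dsimp only
  rw [Finset.sort_insert (· ≤ ·) (by simpa using hlt.le) (by simp)]
  simp [evenPart, oddPart, dividedDeriv_zero, dividedDeriv_one, gammaField_zero B b hε,
    nop_one_constField_right, nop_smul_right, units_inv_smul_smul, oddSign,
    Finset.filter_singleton, hlt.not_gt]

theorem vecG_eq_sum {κ : Type*} [Fintype κ] (a a' : κ → ℂ ⊗[ℤ] Q) : vecG B b ε a a' =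
    ∑ i, evenMode B b (a i) (-1) (oddMode B b (a' i) (-1) (vacuum ε)) := by
  refine Finset.sum_congr rfl fun i _ => ?_
  change (((vQ B b ε).Y (opS B b (stateW B b ε (a i))))[[-1]]) (stateW B b ε (a' i)) = _
  rw [opS_stateW, vQ_Y_evenMode_vacuum B b hε, evenField_ncoeff, stateW]

theorem mode_vecG_one {κ : Type*} [Fintype κ] (a a' : κ → ℂ ⊗[ℤ] Q) (n : ℤ) :
    (vQ B b ε).mode (vecG B b ε a a') n 1 = modeG B b a a' n := by
  change ((vQ B b ε).Y (vecG B b ε a a'))[[n]] = _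
  rw [vecG_eq_sum B b hε, map_sum, modeG]
  simp only [vQ_Y_evenMode_oddMode_vacuum B b hε, map_sum, Finset.sum_apply, nop_ncoeff]

section ConformalVector

variable (hB : B.IsSymm) {κ : Type*} [Fintype κ] [DecidableEq κ]
  {a a' : Module.Basis κ ℂ (ℂ ⊗[ℤ] Q)}
  (hdual : ∀ i j, formW B (a i) (a' j) = if i = j then 1 else 0)
include hB hdual

theorem opS_vecG : opS B b (vecG B b ε a a') =
    ∑ i, (evenMode B b (a i) (-1) (evenMode B b (a' i) (-1) (vacuum ε)) -
      oddMode B b (a' i) (-1) (oddMode B b (a i) (-2) (vacuum ε))) := by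
  rw [vecG_eq_sum B b hε, map_sum]
  refine Finset.sum_congr rfl fun i _ => ?_
  have hanti : oddMode B b (a i) (-2) (oddMode B b (a' i) (-1) (vacuum ε)) =
      -oddMode B b (a' i) (-1) (oddMode B b (a i) (-2) (vacuum ε)) := by
    rw [apply_apply_eq_superBracket (-1 : ℂ), superBracket_oddMode_oddMode b hB,
      if_neg (by norm_num), LinearMap.zero_apply]
    module
  have hodd : opS B b (oddMode B b (a' i) (-1) (vacuum ε)) =
      evenMode B b (a' i) (-1) (vacuum ε) := opS_stateW B b (a' i)
  rw [apply_apply_eq_superBracket (1 : ℂ), superBracket_opS_evenMode b hB hdual, hodd,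
    LinearMap.smul_apply, show (-1 : ℤ) - 1 = -2 by norm_num, hanti]
  push_cast
  module

theorem mode_vecG_zero (n : ℤ) : (vQ B b ε).mode (vecG B b ε a a') n 0 = modeL B b a a' n := by
  change ((vQ B b ε).Y (opS B b (vecG B b ε a a')))[[n]] = _
  rw [opS_vecG B b hε hB hdual, map_sum, modeL_eq_sum_nopMode b hB hdual]
  simp only [map_sub, vQ_Y_evenMode_evenMode_vacuum B b hε hB, vQ_Y_oddMode_oddMode_vacuum B b hε,
    map_sum, Finset.sum_apply, Pi.sub_apply, nop_ncoeff]

end ConformalVector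

end StateField

/-! ### The spectrum of `L_1` -/

section DiagonalOperators

variable {K ι : Type*} [Field K] {X : Module.End K (ι →₀ K)} {d : ι → K}
  (hX : ∀ s x, X (Finsupp.single s x) = d s • Finsupp.single s x)
include hX

theorem diagonal_apply (v : ι →₀ K) (s : ι) : X v s = d s * v s := by
  induction v using Finsupp.induction_linear with
  | zero => simp
  | add v w hv hw => rw [map_add, Finsupp.add_apply, hv, hw, Finsupp.add_apply, mul_add]
  | single t x =>
    rw [hX, Finsupp.smul_apply, smul_eq_mul]
    rcases eq_or_ne t s with rfl | hne
    · rfl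
    · simp [Finsupp.single_eq_of_ne' hne]

theorem eigenspace_diagonal (μ : K) :
    Module.End.eigenspace X μ = Finsupp.supported K K {s | d s = μ} := by
  ext v
  rw [Module.End.mem_eigenspace_iff, Finsupp.mem_supported, DFunLike.ext_iff]
  refine forall_congr' fun s => ?_
  rw [diagonal_apply hX, Finsupp.smul_apply, smul_eq_mul, mul_eq_mul_right_iff, Finset.mem_coe,
    Finsupp.mem_support_iff, Set.mem_ofPred_eq, or_iff_not_imp_right]

theorem iSup_eigenspace_diagonal : ⨆ μ : K, Module.End.eigenspace X μ = ⊤ := by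
  simp_rw [eigenspace_diagonal hX]
  rw [← Finsupp.supported_iUnion,
    Set.iUnion_eq_univ_iff.2 fun s => ⟨d s, rfl⟩, Finsupp.supported_univ]

theorem exists_eq_of_hasEigenvalue_diagonal {μ : K} (hμ : Module.End.HasEigenvalue X μ) :
    ∃ s, d s = μ := by
  obtain ⟨v, hv⟩ := hμ.exists_hasEigenvector
  obtain ⟨s, hs⟩ := Finsupp.support_nonempty_iff.2 hv.2
  exact ⟨s, (eigenspace_diagonal hX μ).le hv.1 hs⟩

theorem finiteDimensional_eigenspace_diagonal {μ : K} (hfin : {s | d s = μ}.Finite) :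
    FiniteDimensional K (Module.End.eigenspace X μ) := by
  have := hfin.to_subtype
  rw [eigenspace_diagonal hX]
  exact Module.Finite.equiv (Finsupp.supportedEquivFinsupp (R := K) (M := K) _).symm

end DiagonalOperators

section FiniteSublevels

variable {ι : Type*} {w : ι → ℤ} {N : ℤ} (hfin : {k | w k ≤ N}.Finite)
include hfin

theorem finite_setOf_sum_le (hw : ∀ k, 0 ≤ w k) : {F : Finset ι | ∑ k ∈ F, w k ≤ N}.Finite := by
  refine hfin.toFinset.powerset.finite_toSet.subset fun F hF => ?_
  refine Finset.mem_powerset.2 fun k hk => hfin.mem_toFinset.2 ?_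
  exact (Finset.single_le_sum (fun l _ => hw l) hk).trans hF

theorem finite_setOf_finsuppSum_le (hw : ∀ k, 0 < w k) :
    {ν : ι →₀ ℕ | ν.sum (fun k c => (c : ℤ) * w k) ≤ N}.Finite := by
  refine (hfin.toFinset.finsupp fun _ => Finset.range (N.toNat + 1)).finite_toSet.subset
    fun ν hν => ?_
  have hterm : ∀ k ∈ ν.support, (ν k : ℤ) * w k ≤ N := fun k hk =>
    (Finset.single_le_sum (f := fun k => (ν k : ℤ) * w k)
      (fun l _ => mul_nonneg (Int.natCast_nonneg _) (hw l).le) hk).trans hν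
  rw [Finset.mem_coe, Finset.mem_finsupp_iff]
  refine ⟨fun k hk => hfin.mem_toFinset.2 ?_, fun k _ => Finset.mem_range_succ_iff.2 ?_⟩
  · have hone : (1 : ℤ) ≤ ν k := by
      have hne := Finsupp.mem_support_iff.1 hk
      omega
    exact (le_mul_of_one_le_left (hw k).le hone).trans (hterm k hk)
  · by_cases hk : k ∈ ν.support
    · have hle := (le_mul_of_one_le_right (Int.natCast_nonneg (ν k)) (hw k)).trans (hterm k hk)
      omega
    · simp [Finsupp.notMem_support_iff.1 hk]

end FiniteSublevels

section PositiveForms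

variable {Q : Type*} [AddCommGroup Q] {B : LinearMap.BilinForm ℤ Q}
  (hpos : ∀ α : Q, α ≠ 0 → 0 < B α α)
include hpos

theorem form_self_nonneg (α : Q) : 0 ≤ B α α := by
  rcases eq_or_ne α 0 with rfl | hα
  · simp
  · exact (hpos α hα).le

theorem finite_setOf_form_self_le [Module.Finite ℤ Q] (hB : B.IsSymm) (N : ℤ) :
    {β : Q | B β β ≤ N}.Finite := by
  classical
  obtain ⟨S, hS⟩ := Module.Finite.fg_top (R := ℤ) (M := Q)
  have hinj : Function.Injective fun (β : Q) (γ : S) => B β γ := fun β γ h => by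
    have hzero : B (β - γ) = 0 := LinearMap.ext_on hS fun δ hδ => by
      simpa [sub_eq_zero] using congrFun h ⟨δ, hδ⟩
    by_contra hne
    simpa [hzero] using hpos (β - γ) (sub_ne_zero.2 hne)
  refine Set.Finite.of_finite_image (f := fun (β : Q) (γ : S) => B β γ) ?_ hinj.injOn
  refine (Set.finite_Icc (fun γ : S => -(N * B γ γ)) fun γ => N * B γ γ).subset ?_
  rintro _ ⟨β, hβ, rfl⟩
  have hbound : ∀ γ, |B β γ| ≤ N * B γ γ := fun γ =>
    calc |B β γ| ≤ B β γ ^ 2 := (Int.le_self_sq _).trans_eq (sq_abs _)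
      _ ≤ B β β * B γ γ :=
        LinearMap.BilinForm.apply_sq_le_of_symm B (form_self_nonneg hpos) ⟨hB.eq⟩ β γ
      _ ≤ N * B γ γ := mul_le_mul_of_nonneg_right hβ (form_self_nonneg hpos γ)
  exact ⟨fun γ => (abs_le.1 (hbound γ)).1, fun γ => (abs_le.1 (hbound γ)).2⟩

end PositiveForms

section Spectrum

variable {r : ℕ} {Q : Type*} [AddCommGroup Q]
  (B : LinearMap.BilinForm ℤ Q) (b : Module.Basis (Fin r) ℤ Q)

omit [AddCommGroup Q] in
theorem evenDegree_add_single (ν : ModeIdx r →₀ ℕ) (F : Finset (ModeIdx r)) (β : Q)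
    (k : ModeIdx r) :
    evenDegree (ν + Finsupp.single k 1, F, β) = evenDegree (ν, F, β) + ((ofLex k).1 + 1) := by
  simp only [evenDegree]
  rw [Finsupp.sum_add_index' (by simp) (by intros; push_cast; ring),
    Finsupp.sum_single_index (by simp)]
  simp

/-- Twice the conformal weight of a Poincaré–Birkhoff–Witt basis vector: `(b i)_(-m-1|0)` has
weight `m + 1`, `(b i)_(-m-1|1)` has weight `m + 1/2`, and `e^β` has weight `(β, β) / 2`. -/
def fockWeight (s : FockIdx r Q) : ℤ :=
  2 * evenDegree s + ∑ k ∈ s.2.1, (2 * ((ofLex k).1 : ℤ) + 1) + B s.2.2 s.2.2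

variable {B}

theorem fockWeight_nonneg (hpos : ∀ α : Q, α ≠ 0 → 0 < B α α) (s : FockIdx r Q) :
    0 ≤ fockWeight B s :=
  add_nonneg (add_nonneg (mul_nonneg two_pos.le (evenDegree_nonneg s))
    (Finset.sum_nonneg fun _ _ => by positivity)) (form_self_nonneg hpos _)

theorem finite_setOf_modeIdx_le (r : ℕ) (N : ℤ) :
    {k : ModeIdx r | ((ofLex k).1 : ℤ) ≤ N}.Finite := by
  refine (((Set.finite_Iic N.toNat).prod (Set.finite_univ (α := Fin r))).preimage
    ofLex.injective.injOn).subset fun k hk => ⟨?_, Set.mem_univ _⟩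
  rw [Set.mem_ofPred_eq] at hk
  rw [Set.mem_Iic]
  omega

include b in
theorem finite_setOf_fockWeight_le (hB : B.IsSymm) (hpos : ∀ α : Q, α ≠ 0 → 0 < B α α) (N : ℤ) :
    {s : FockIdx r Q | fockWeight B s ≤ N}.Finite := by
  have : Module.Finite ℤ Q := .of_basis b
  have heven : {ν : ModeIdx r →₀ ℕ | ν.sum (fun k c => (c : ℤ) * ((ofLex k).1 + 1)) ≤ N}.Finite :=
    finite_setOf_finsuppSum_le ((finite_setOf_modeIdx_le r N).subset fun k hk => by
      rw [Set.mem_ofPred_eq] at hk ⊢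
      omega) fun k => by positivity
  have hodd : {F : Finset (ModeIdx r) | ∑ k ∈ F, (2 * ((ofLex k).1 : ℤ) + 1) ≤ N}.Finite :=
    finite_setOf_sum_le ((finite_setOf_modeIdx_le r N).subset fun k hk => by
      rw [Set.mem_ofPred_eq] at hk ⊢
      omega) fun k => by positivity
  refine (heven.prod (hodd.prod (finite_setOf_form_self_le hpos hB N))).subset fun s hs => ?_
  have hs' : 2 * evenDegree s + ∑ k ∈ s.2.1, (2 * ((ofLex k).1 : ℤ) + 1) + B s.2.2 s.2.2 ≤ N := hs
  have hevenDegree := evenDegree_nonneg s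
  have hsum : 0 ≤ ∑ k ∈ s.2.1, (2 * ((ofLex k).1 : ℤ) + 1) :=
    Finset.sum_nonneg fun _ _ => by positivity
  have hform := form_self_nonneg hpos s.2.2
  refine ⟨show evenDegree s ≤ N by omega, ?_, ?_⟩ <;>
  · rw [Set.mem_ofPred_eq]
    omega

section Eigenvalues

variable (hB : B.IsSymm) {κ : Type*} [Fintype κ] [DecidableEq κ]
  {a a' : Module.Basis κ ℂ (ℂ ⊗[ℤ] Q)}
  (hdual : ∀ i j, formW B (a i) (a' j) = if i = j then 1 else 0)
include hB hdual

theorem modeL_one_single_oddLabels (F : Finset (ModeIdx r)) (β : Q) (x : ℂ) :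
    modeL B b a a' 1 (Finsupp.single (0, F, β) x) =
      (fockWeight B ((0, F, β) : FockIdx r Q) : ℂ) • Finsupp.single (0, F, β) x := by
  induction F using Finset.induction_on with
  | empty =>
    rw [modeL_ground_of_pos b hB hdual one_pos, sub_self, evenMode_zero_single, formW_toW]
    simp [fockWeight, evenDegree]
  | insert k F hk ih =>
    have hinsert : Finsupp.single (0, insert k F, β) x = oddSign F k •
        oddMode B b (toW (b (ofLex k).2)) (-((ofLex k).1 : ℤ) - 1)
          (Finsupp.single (0, F, β) x) := by
      rw [oddMode_basis_neg, show toLex ((ofLex k).1, (ofLex k).2) = k from rfl, oddCreate_single,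
        if_neg hk, Finsupp.smul_single, smul_eq_mul, mul_left_comm, oddSign_mul_self, mul_one]
    have hbracket := superBracket_modeL_oddMode b hB hdual (toW (b (ofLex k).2))
      (-((ofLex k).1 : ℤ) - 1) 1
    rw [sub_self, zero_add] at hbracket
    rw [hinsert, map_smul, apply_apply_of_eigenvector hbracket ih, smul_comm]
    congr 1
    simp only [fockWeight, Finset.sum_insert hk, evenDegree]
    push_cast
    ring

theorem modeL_one_single_add_single {ν : ModeIdx r →₀ ℕ} {F : Finset (ModeIdx r)} {β : Q} {x : ℂ}
    (hν : modeL B b a a' 1 (Finsupp.single (ν, F, β) x) =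
      (fockWeight B ((ν, F, β) : FockIdx r Q) : ℂ) • Finsupp.single (ν, F, β) x)
    (k : ModeIdx r) :
    modeL B b a a' 1 (Finsupp.single (ν + Finsupp.single k 1, F, β) x) =
      (fockWeight B ((ν + Finsupp.single k 1, F, β) : FockIdx r Q) : ℂ) •
        Finsupp.single (ν + Finsupp.single k 1, F, β) x := by
  have hcreate : Finsupp.single (ν + Finsupp.single k 1, F, β) x =
      evenMode B b (toW (b (ofLex k).2)) (-((ofLex k).1 : ℤ) - 1) (Finsupp.single (ν, F, β) x) := by
    rw [evenMode_basis_neg]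
    exact (evenCreate_single k (ν, F, β) x).symm
  have hbracket := superBracket_modeL_evenMode b hB hdual (toW (b (ofLex k).2))
    (-((ofLex k).1 : ℤ) - 1) 1
  rw [sub_self, zero_add] at hbracket
  rw [hcreate, apply_apply_of_eigenvector hbracket hν]
  congr 1
  simp only [fockWeight, evenDegree_add_single]
  push_cast
  ring

theorem modeL_one_single (s : FockIdx r Q) (x : ℂ) :
    modeL B b a a' 1 (Finsupp.single s x) = (fockWeight B s : ℂ) • Finsupp.single s x := by
  obtain ⟨ν, F, β⟩ := s
  obtain ⟨M, rfl⟩ := Multiset.toFinsupp.surjective ν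
  induction M using Multiset.induction_on with
  | empty => simpa using modeL_one_single_oddLabels b hB hdual F β x
  | cons k M ih =>
    rw [← Multiset.singleton_add, add_comm, map_add, Multiset.toFinsupp_singleton]
    exact modeL_one_single_add_single b hB hdual ih k

end Eigenvalues

end Spectrum

/-! ### `Λ`-brackets with `G` -/

namespace SUSYStructure

variable {V : Type*} [AddCommGroup V] [Module ℂ V] (𝒱 : SUSYStructure V) {τ v : V}

theorem lambdaBracket_eq_of_mode_eq_zero (heven : ∀ n : ℤ, 2 ≤ n → 𝒱.mode τ n 0 v = 0)
    (hone : 𝒱.mode τ 1 1 v = 0) (hodd : ∀ n : ℤ, 3 ≤ n → 𝒱.mode τ n 1 v = 0) :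
    𝒱.lambdaBracket τ v = mon 0 0 (𝒱.mode τ 0 0 v) + mon 1 0 (𝒱.mode τ 1 0 v) +
      mon 0 1 (𝒱.mode τ 0 1 v) + mon 2 1 ((2 : ℂ)⁻¹ • 𝒱.mode τ 2 1 v) := by
  ext ⟨j, J⟩
  simp only [mon, Finsupp.add_apply, Finsupp.single_apply, Prod.mk.injEq]
  change ((j.factorial : ℂ)⁻¹) • 𝒱.mode τ j J v = _
  match j, J with
  | 0, 0 | 0, 1 | 1, 0 | 2, 1 => simp
  | 1, 1 => simp [hone]
  | j + 2, 0 => rw [heven ((j + 2 : ℕ) : ℤ) (by omega)]; simp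
  | j + 3, 1 => rw [hodd ((j + 3 : ℕ) : ℤ) (by omega)]; simp

theorem isPrimary_of_mode {Δ : ℂ} (hT : 𝒱.mode τ 0 0 = (2 : ℂ) • 𝒱.T) (hS : 𝒱.mode τ 0 1 = 𝒱.S)
    (hweight : 𝒱.mode τ 1 0 v = (2 * Δ) • v) (heven : ∀ n : ℤ, 2 ≤ n → 𝒱.mode τ n 0 v = 0)
    (hodd : ∀ n : ℤ, 1 ≤ n → 𝒱.mode τ n 1 v = 0) : 𝒱.IsPrimary τ v Δ := by
  rw [IsPrimary, 𝒱.lambdaBracket_eq_of_mode_eq_zero heven (hodd 1 le_rfl)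
    fun n hn => hodd n (by omega), hT, hS, hweight, hodd 2 one_le_two]
  simp [mon]

theorem isNeveuSchwarz_of_mode {c : ℂ} (hT : 𝒱.mode τ 0 0 = (2 : ℂ) • 𝒱.T)
    (hS : 𝒱.mode τ 0 1 = 𝒱.S) (hweight : 𝒱.mode τ 1 0 τ = (3 : ℂ) • τ)
    (heven : ∀ n : ℤ, 2 ≤ n → 𝒱.mode τ n 0 τ = 0) (hone : 𝒱.mode τ 1 1 τ = 0)
    (hcentral : 𝒱.mode τ 2 1 τ = (2 * c / 3) • 𝒱.vac)
    (hodd : ∀ n : ℤ, 3 ≤ n → 𝒱.mode τ n 1 τ = 0) : 𝒱.IsNeveuSchwarz τ c := by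
  rw [IsNeveuSchwarz, 𝒱.lambdaBracket_eq_of_mode_eq_zero heven hone hodd, hT, hS, hweight,
    hcentral, smul_smul, show (2 : ℂ)⁻¹ * (2 * c / 3) = c / 3 by ring, LinearMap.smul_apply]

end SUSYStructure

section Brackets

variable {r : ℕ} {Q : Type*} [AddCommGroup Q]
  (B : LinearMap.BilinForm ℤ Q) (b : Module.Basis (Fin r) ℤ Q) {ε : Q → Q → ℂˣ}

theorem evenMode_vacuum_of_nonneg (h : ℂ ⊗[ℤ] Q) {n : ℤ} (hn : 0 ≤ n) :
    evenMode B b h n (vacuum ε) = 0 := by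
  rw [vacuum]
  rcases hn.eq_or_lt with rfl | hn
  · rw [evenMode_zero_single, toW_zero, map_zero, zero_smul]
  · exact evenMode_ground_of_pos B b h hn 0 _

theorem evenMode_stateW_of_nonneg (h h' : ℂ ⊗[ℤ] Q) {n : ℤ} (hn : 0 ≤ n) :
    evenMode B b h n (stateW B b ε h') = 0 := by
  rw [stateW, ← Module.End.mul_apply, (evenMode_commute_oddMode B b h h' n (-1)).eq,
    Module.End.mul_apply, evenMode_vacuum_of_nonneg B b h hn, map_zero]

variable {B} (hB : B.IsSymm)
include hB

theorem oddMode_stateW_of_nonneg (h h' : ℂ ⊗[ℤ] Q) {n : ℤ} (hn : 0 ≤ n) :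
    oddMode B b h n (stateW B b ε h') = (if n = 0 then formW B h h' else 0) • vacuum ε := by
  rw [stateW, apply_apply_eq_superBracket (-1 : ℂ), superBracket_oddMode_oddMode b hB, vacuum,
    oddMode_ground_of_nonneg B b h hn, map_zero, smul_zero, add_zero]
  rcases hn.eq_or_lt with rfl | hn
  · simp
  · rw [if_neg (by omega), if_neg hn.ne', zero_smul, LinearMap.zero_apply]

variable {κ : Type*} [Fintype κ] [DecidableEq κ]
  {a a' : Module.Basis κ ℂ (ℂ ⊗[ℤ] Q)}
  (hdual : ∀ i j, formW B (a i) (a' j) = if i = j then 1 else 0)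
include hdual

theorem modeL_zero : modeL B b a a' 0 = (2 : ℂ) • (opS B b * opS B b) := by
  rw [modeL, modeG_zero b hB hdual, superBracket_apply]
  module

theorem modeL_ground_of_two_le {n : ℤ} (hn : 2 ≤ n) (β : Q) (x : ℂ) :
    modeL B b a a' n (Finsupp.single (0, ∅, β) x) = 0 := by
  rw [modeL_ground_of_pos b hB hdual (by omega), evenMode_ground_of_pos B b _ (by omega)]

theorem modeL_one_ground (β : Q) (x : ℂ) :
    modeL B b a a' 1 (Finsupp.single (0, ∅, β) x) =
      (B β β : ℂ) • Finsupp.single (0, ∅, β) x := by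
  rw [modeL_one_single b hB hdual]
  simp [fockWeight, evenDegree]

theorem modeG_stateW_of_pos (h : ℂ ⊗[ℤ] Q) {n : ℤ} (hn : 0 < n) :
    modeG B b a a' n (stateW B b ε h) = 0 := by
  rw [stateW, apply_apply_eq_superBracket (-1 : ℂ), superBracket_comm (by norm_num),
    superBracket_oddMode_modeG b hB hdual, LinearMap.smul_apply,
    evenMode_vacuum_of_nonneg B b h (by omega), vacuum, modeG_ground_of_pos B b _ _ hn, map_zero,
    smul_zero, smul_zero, add_zero]

theorem modeL_stateW_of_two_le (h : ℂ ⊗[ℤ] Q) {n : ℤ} (hn : 2 ≤ n) :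
    modeL B b a a' n (stateW B b ε h) = 0 := by
  rw [stateW, apply_apply_eq_superBracket (1 : ℂ), superBracket_modeL_oddMode b hB hdual,
    LinearMap.smul_apply, vacuum, oddMode_ground_of_nonneg B b h (by omega),
    modeL_ground_of_two_le b hB hdual hn, map_zero, smul_zero, smul_zero, add_zero]

theorem modeL_one_stateW (h : ℂ ⊗[ℤ] Q) :
    modeL B b a a' 1 (stateW B b ε h) = stateW B b ε h := by
  have hbracket := superBracket_modeL_oddMode b hB hdual h (-1) 1
  have hvacuum : modeL B b a a' 1 (vacuum ε) = (B 0 0 : ℂ) • vacuum ε :=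
    modeL_one_ground b hB hdual 0 _
  rw [sub_self, zero_add] at hbracket
  rw [stateW, apply_apply_of_eigenvector hbracket hvacuum]
  norm_num

section ConformalVector

variable (hε : ∀ β, ε 0 β = ε 0 0)
include hε

theorem modeL_one_vecG :
    modeL B b a a' 1 (vecG B b ε a a') = (3 : ℂ) • vecG B b ε a a' := by
  rw [vecG_eq_sum B b hε, map_sum, Finset.smul_sum]
  refine Finset.sum_congr rfl fun i _ => ?_
  have hbracket := superBracket_modeL_evenMode b hB hdual (a i) (-1) 1
  have hstate : modeL B b a a' 1 (stateW B b ε (a' i)) = (1 : ℂ) • stateW B b ε (a' i) := by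
    rw [modeL_one_stateW b hB hdual, one_smul]
  rw [sub_self, zero_add] at hbracket
  rw [← stateW, apply_apply_of_eigenvector hbracket hstate]
  norm_num

theorem modeL_vecG_of_two_le {n : ℤ} (hn : 2 ≤ n) :
    modeL B b a a' n (vecG B b ε a a') = 0 := by
  rw [vecG_eq_sum B b hε, map_sum]
  refine Finset.sum_eq_zero fun i _ => ?_
  rw [← stateW, apply_apply_eq_superBracket (1 : ℂ), superBracket_modeL_evenMode b hB hdual,
    LinearMap.smul_apply, evenMode_stateW_of_nonneg B b _ _ (by omega),
    modeL_stateW_of_two_le b hB hdual _ hn, map_zero, smul_zero, smul_zero, add_zero]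

theorem modeG_vecG_of_pos {n : ℤ} (hn : 0 < n) :
    modeG B b a a' n (vecG B b ε a a') =
      ∑ i, oddMode B b (a i) (n - 2) (stateW B b ε (a' i)) := by
  rw [vecG_eq_sum B b hε, map_sum]
  refine Finset.sum_congr rfl fun i _ => ?_
  rw [← stateW, apply_apply_eq_superBracket (1 : ℂ), superBracket_comm (one_mul 1),
    superBracket_evenMode_modeG b hB hdual, modeG_stateW_of_pos b hB hdual _ hn, map_zero,
    show n - 1 + -1 = n - 2 by ring]
  simp

theorem modeG_one_vecG : modeG B b a a' 1 (vecG B b ε a a') = 0 := by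
  let quad : ℂ ⊗[ℤ] Q →ₗ[ℂ] ℂ ⊗[ℤ] Q →ₗ[ℂ] Fock r Q :=
    (oddModeₗ B b (-1)).compl₂ ((oddModeₗ B b (-1)).flip (vacuum ε))
  have hanti (h h' : ℂ ⊗[ℤ] Q) : quad h' h = -quad h h' := by
    change oddMode B b h' (-1) (oddMode B b h (-1) (vacuum ε)) =
      -oddMode B b h (-1) (oddMode B b h' (-1) (vacuum ε))
    rw [apply_apply_eq_superBracket (-1 : ℂ), superBracket_oddMode_oddMode b hB,
      if_neg (by norm_num), LinearMap.zero_apply]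
    module
  have hquad : modeG B b a a' 1 (vecG B b ε a a') = ∑ i, quad (a i) (a' i) :=
    modeG_vecG_of_pos b hB hdual hε one_pos
  rw [hquad, ← self_eq_neg, ← Finset.sum_neg_distrib]
  simp only [← hanti]
  exact sum_map₂_swap_of_dual (formW_symm hB) hdual quad

theorem modeG_two_vecG :
    modeG B b a a' 2 (vecG B b ε a a') = (Fintype.card κ : ℂ) • vacuum ε := by
  rw [modeG_vecG_of_pos b hB hdual hε two_pos]
  simp [oddMode_stateW_of_nonneg b hB, hdual, Nat.cast_smul_eq_nsmul]

theorem modeG_vecG_of_three_le {n : ℤ} (hn : 3 ≤ n) :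
    modeG B b a a' n (vecG B b ε a a') = 0 := by
  rw [modeG_vecG_of_pos b hB hdual hε (by omega)]
  refine Finset.sum_eq_zero fun i _ => ?_
  rw [oddMode_stateW_of_nonneg b hB _ _ (by omega), if_neg (by omega), zero_smul]

end ConformalVector

end Brackets

section MainResults

variable {r : ℕ} {Q : Type*} [AddCommGroup Q]
  {B : LinearMap.BilinForm ℤ Q} (b : Module.Basis (Fin r) ℤ Q) {ε : Q → Q → ℂˣ}
  (hB : B.IsSymm) (hε : ∀ β, ε 0 β = ε 0 0) {κ : Type*} [Fintype κ] [DecidableEq κ]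
  {a a' : Module.Basis κ ℂ (ℂ ⊗[ℤ] Q)}
  (hdual : ∀ i j, formW B (a i) (a' j) = if i = j then 1 else 0)
include hB hε hdual

theorem mode_vecG_zero_zero :
    (vQ B b ε).mode (vecG B b ε a a') 0 0 = (2 : ℂ) • (vQ B b ε).T :=
  (mode_vecG_zero B b hε hB hdual 0).trans (modeL_zero b hB hdual)

theorem mode_vecG_zero_one : (vQ B b ε).mode (vecG B b ε a a') 0 1 = (vQ B b ε).S :=
  (mode_vecG_one B b hε a a' 0).trans (modeG_zero b hB hdual)

theorem isNeveuSchwarz_vecG :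
    (vQ B b ε).IsNeveuSchwarz (vecG B b ε a a') (3 / 2 * (Module.finrank ℤ Q : ℂ)) := by
  have : Module.Free ℤ Q := .of_basis b
  have hcard : Fintype.card κ = Module.finrank ℤ Q := by
    rw [← Module.finrank_eq_card_basis a, Module.finrank_baseChange]
  refine (vQ B b ε).isNeveuSchwarz_of_mode (mode_vecG_zero_zero b hB hε hdual)
    (mode_vecG_zero_one b hB hε hdual) ?_ (fun n hn => ?_) ?_ ?_ fun n hn => ?_
  · rw [mode_vecG_zero B b hε hB hdual, modeL_one_vecG b hB hdual hε]
  · rw [mode_vecG_zero B b hε hB hdual, modeL_vecG_of_two_le b hB hdual hε hn]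
  · rw [mode_vecG_one B b hε, modeG_one_vecG b hB hdual hε]
  · rw [mode_vecG_one B b hε, modeG_two_vecG b hB hdual hε, hcard,
      show 2 * (3 / 2 * (Module.finrank ℤ Q : ℂ)) / 3 = Module.finrank ℤ Q by ring]
    rfl
  · rw [mode_vecG_one B b hε, modeG_vecG_of_three_le b hB hdual hε hn]

theorem isConformalVector_vecG :
    (vQ B b ε).IsConformalVector (vecG B b ε a a') (3 / 2 * (Module.finrank ℤ Q : ℂ)) where
  neveuSchwarz := isNeveuSchwarz_vecG b hB hε hdual
  mode_zero_zero := mode_vecG_zero_zero b hB hε hdual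
  mode_zero_one := mode_vecG_zero_one b hB hε hdual
  diagonalizable := by
    rw [mode_vecG_zero B b hε hB hdual]
    exact iSup_eigenspace_diagonal (modeL_one_single b hB hdual)

theorem energyBoundedBelow_vecG (hpos : ∀ α : Q, α ≠ 0 → 0 < B α α) :
    (vQ B b ε).EnergyBoundedBelow (vecG B b ε a a') := by
  rw [SUSYStructure.EnergyBoundedBelow, mode_vecG_zero B b hε hB hdual]
  have hdiag := modeL_one_single b hB hdual
  refine ⟨⟨0, fun μ hμ => ?_⟩, fun μ => finiteDimensional_eigenspace_diagonal hdiag ?_⟩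
  · obtain ⟨s, rfl⟩ := exists_eq_of_hasEigenvalue_diagonal hdiag hμ
    exact ⟨fockWeight B s, by exact_mod_cast fockWeight_nonneg hpos s, by simp⟩
  · rcases Set.eq_empty_or_nonempty {s : FockIdx r Q | (fockWeight B s : ℂ) = μ} with hμ | ⟨s, rfl⟩
    · exact hμ ▸ Set.finite_empty
    · exact (finite_setOf_fockWeight_le b hB hpos (fockWeight B s)).subset
        fun t ht => (Int.cast_injective ht).le

theorem isPrimary_stateW (h : ℂ ⊗[ℤ] Q) :
    (vQ B b ε).IsPrimary (vecG B b ε a a') (stateW B b ε h) (1 / 2) := by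
  refine (vQ B b ε).isPrimary_of_mode (mode_vecG_zero_zero b hB hε hdual)
    (mode_vecG_zero_one b hB hε hdual) ?_ (fun n hn => ?_) fun n hn => ?_
  · rw [mode_vecG_zero B b hε hB hdual, modeL_one_stateW b hB hdual]
    norm_num
  · rw [mode_vecG_zero B b hε hB hdual, modeL_stateW_of_two_le b hB hdual h hn]
  · rw [mode_vecG_one B b hε, modeG_stateW_of_pos b hB hdual h (by omega)]

theorem isPrimary_stateExp (α : Q) :
    (vQ B b ε).IsPrimary (vecG B b ε a a') (stateExp r α) ((B α α : ℂ) / 2) := by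
  refine (vQ B b ε).isPrimary_of_mode (mode_vecG_zero_zero b hB hε hdual)
    (mode_vecG_zero_one b hB hε hdual) ?_ (fun n hn => ?_) fun n hn => ?_
  · rw [mode_vecG_zero B b hε hB hdual, stateExp, modeL_one_ground b hB hdual,
      mul_div_cancel₀ _ two_ne_zero]
  · rw [mode_vecG_zero B b hε hB hdual, stateExp, modeL_ground_of_two_le b hB hdual hn]
  · rw [mode_vecG_one B b hε, stateExp, modeG_ground_of_pos B b a a' (by omega)]

end MainResults

end SUSYLattice

end

theorem mainTheorem2_general {Q : Type*} [AddCommGroup Q] {r : ℕ}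
    (b : Module.Basis (Fin r) ℤ Q) (B : LinearMap.BilinForm ℤ Q) (hsymm : B.IsSymm)
    (ε : Q → Q → ℂˣ) (hε : ∀ β : Q, ε 0 β = ε 0 0)
    {κ : Type*} [Fintype κ] [DecidableEq κ]
    (a a' : Module.Basis κ ℂ (TensorProduct ℤ ℂ Q))
    (hdual : ∀ i j, SUSYLattice.formW B (a i) (a' j) = if i = j then 1 else 0) :
    (SUSYLattice.vQ B b ε).IsConformalVector (SUSYLattice.vecG B b ε a a')
      (3 / 2 * (Module.finrank ℤ Q : ℂ)) ∧
    ((∀ α : Q, α ≠ 0 → 0 < B α α) →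
      (SUSYLattice.vQ B b ε).EnergyBoundedBelow (SUSYLattice.vecG B b ε a a')) ∧
    (∀ h : TensorProduct ℤ ℂ Q,
      (SUSYLattice.vQ B b ε).IsPrimary (SUSYLattice.vecG B b ε a a')
        (SUSYLattice.stateW B b ε h) (1 / 2)) ∧
    (∀ α : Q,
      (SUSYLattice.vQ B b ε).IsPrimary (SUSYLattice.vecG B b ε a a')
        (SUSYLattice.stateExp r α) ((B α α : ℂ) / 2)) :=
  ⟨SUSYLattice.isConformalVector_vecG b hsymm hε hdual,
    SUSYLattice.energyBoundedBelow_vecG b hsymm hε hdual,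
    SUSYLattice.isPrimary_stateW b hsymm hε hdual,
    SUSYLattice.isPrimary_stateExp b hsymm hε hdual⟩

theorem mainTheorem2 {Q : Type*} [AddCommGroup Q] {r : ℕ} (b : Module.Basis (Fin r) ℤ Q)
    (B : LinearMap.BilinForm ℤ Q) (hsymm : B.IsSymm) (hnondeg : B.Nondegenerate)
    (ε : Q → Q → ℂˣ)
    (hcocycle : ∀ α β γ : Q, ε α β * ε (α + β) γ = ε β γ * ε α (β + γ))
    (hlocal : ∀ α β : Q, ε α β = (-1 : ℂˣ) ^ (B α β + B α α * B β β) * ε β α)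
    {κ : Type*} [Fintype κ] [DecidableEq κ]
    (a a' : Module.Basis κ ℂ (TensorProduct ℤ ℂ Q))
    (hdual : ∀ i j, SUSYLattice.formW B (a i) (a' j) = if i = j then 1 else 0) :
    (SUSYLattice.vQ B b ε).IsConformalVector (SUSYLattice.vecG B b ε a a')
      (3 / 2 * (Module.finrank ℤ Q : ℂ)) ∧
    ((∀ α : Q, α ≠ 0 → 0 < B α α) →
      (SUSYLattice.vQ B b ε).EnergyBoundedBelow (SUSYLattice.vecG B b ε a a')) ∧
    (∀ h : TensorProduct ℤ ℂ Q,
      (SUSYLattice.vQ B b ε).IsPrimary (SUSYLattice.vecG B b ε a a')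
        (SUSYLattice.stateW B b ε h) (1 / 2)) ∧
    (∀ α : Q,
      (SUSYLattice.vQ B b ε).IsPrimary (SUSYLattice.vecG B b ε a a')
        (SUSYLattice.stateExp r α) ((B α α : ℂ) / 2)) := by
  exact mainTheorem2_general b B hsymm ε (SUSYLattice.cocycle_zero_left hcocycle) a a' hdual
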